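/- Let $n\ge 2$, $\nu\in(0,1]$, $\beta_1,\dots,\beta_n>0$ and $\bar\beta=\sum_{j=1}^n\beta_j$. For $a,b,\delta>0$ and $z\in\mathbb R$ let $$E^{\delta}_{a,b}(z)=\sum_{r=0}^\infty \frac{z^r}{\Gamma(ar+b)}\,\frac{\Gamma(\delta+r)}{r!\,\Gamma(\delta)}$$ be the three-parameter Mittag-Leffler function. The fractional Dirichlet distribution is the distribution of the vector $(Q_1,\dots,Q_{n-1})$ on the open simplex $\{q_1,\dots,q_{n-1}>0,\ \sum_{j=1}^{n-1}q_j<1\}$ with Lebesgue density $$f_{\mathbf Q}(q_1,\dots,q_{n-1})=\Big(\prod_{j=1}^{n-1}q_j^{\nu\beta_j-1}\Big)\Big(1-\sum_{j=1}^{n-1}q_j\Big)^{\nu\beta_n-1}\int_0^\infty y^{\nu\bar\beta-1}\prod_{j=1}^{n-1}E^{\beta_j}_{\nu,\nu\beta_j}\big(-(yq_j)^\nu\big)\;E^{\beta_n}_{\nu,\nu\beta_n}\Big(-\Big(y-y\sum_{j=1}^{n-1}q_j\Big)^\nu\Big)\,dy ,$$ and $Q_n=1-\sum_{j=1}^{n-1}Q_j$.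 Then for every $i\in\{1,\dots,n\}$ the one-dimensional marginal distribution of $Q_i$ is concentrated on $(0,1)$ and has there the Lebesgue density $$f_{Q_i}(q)=q^{\nu\beta_i-1}(1-q)^{\nu(\bar\beta-\beta_i)-1}\int_0^\infty y^{\nu\bar\beta-1}E^{\beta_i}_{\nu,\nu\beta_i}\big(-(yq)^\nu\big)\,E^{\bar\beta-\beta_i}_{\nu,\nu(\bar\beta-\beta_i)}\big(-(y(1-q))^\nu\big)\,dy ,$$ where for every $q\in(0,1)$ the integral converges absolutely and $f_{Q_i}(q)\ge 0$. -/

import Mathlib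

open MeasureTheory Set
open scoped BigOperators

noncomputable section

namespace FracDirichlet

/-- The three-parameter Mittag-Leffler (Prabhakar) function `E^δ_{a,b}(z)`, for real parameters
and real argument. -/
def mittagLeffler (a b δ z : ℝ) : ℝ :=
  ∑' r : ℕ, z ^ r / Real.Gamma (a * r + b) * (Real.Gamma (δ + r) / (r.factorial * Real.Gamma δ))

/-- The open simplex `{q₁, …, q_m > 0, q₁ + ⋯ + q_m < 1}` in `ℝ^m`, where `m = n - 1`. -/
def openSimplex (m : ℕ) : Set (Fin m → ℝ) :=
  {q | (∀ i, 0 < q i) ∧ ∑ i, q i < 1}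

/-- The joint density of `(Q₁, …, Q_{n-1})`, with `n = m + 1`. The parameters `β₁, …, β_{n-1}`
are `β i.castSucc`, and `β_n` is `β (Fin.last m)`. -/
def jointDensity (m : ℕ) (ν : ℝ) (β : Fin (m + 1) → ℝ) (q : Fin m → ℝ) : ℝ :=
  (∏ i : Fin m, q i ^ (ν * β i.castSucc - 1))
    * (1 - ∑ i, q i) ^ (ν * β (Fin.last m) - 1)
    * ∫ y in Ioi (0 : ℝ), y ^ (ν * (∑ j, β j) - 1)
        * (∏ i : Fin m, mittagLeffler ν (ν * β i.castSucc) (β i.castSucc) (-((y * q i) ^ ν)))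
        * mittagLeffler ν (ν * β (Fin.last m)) (β (Fin.last m)) (-((y - y * ∑ i, q i) ^ ν))

/-- The fractional Dirichlet distribution on `ℝ^m`, `m = n - 1`: the measure with density
`jointDensity` on the open simplex (and zero outside) with respect to Lebesgue measure. -/
def fracDirichlet (m : ℕ) (ν : ℝ) (β : Fin (m + 1) → ℝ) : Measure (Fin m → ℝ) :=
  (volume.restrict (openSimplex m)).withDensity fun q => ENNReal.ofReal (jointDensity m ν β q)

/-- The random variables `Q₁, …, Q_n` as functions of `(q₁, …, q_{n-1})`: the first `n - 1` are
the coordinates, and `Q_n = 1 - (q₁ + ⋯ + q_{n-1})`. -/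
def coordQ (m : ℕ) (i : Fin (m + 1)) (q : Fin m → ℝ) : ℝ :=
  Fin.snoc (α := fun _ => ℝ) q (1 - ∑ j, q j) i

/-- The integrand (in `y`) of the marginal density, with `b = β_i` and `s = β₁ + ⋯ + β_n`. -/
def marginalIntegrand (ν b s q y : ℝ) : ℝ :=
  y ^ (ν * s - 1)
    * mittagLeffler ν (ν * b) b (-((y * q) ^ ν))
    * mittagLeffler ν (ν * (s - b)) (s - b) (-((y * (1 - q)) ^ ν))

/-- The marginal density of `Q_i`, with `b = β_i` and `s = β₁ + ⋯ + β_n`. -/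
def marginalDensity (ν b s q : ℝ) : ℝ :=
  q ^ (ν * b - 1) * (1 - q) ^ (ν * (s - b) - 1)
    * ∫ y in Ioi (0 : ℝ), marginalIntegrand ν b s q y

end FracDirichlet

end

/-!
# Marginals of the fractional Dirichlet distribution

Put `h_b(x) = x ^ (νb - 1) E^b_{ν,νb}(-x ^ ν)` for `x > 0` (`mlDensity`). The joint density of
`(Q_1, …, Q_n)` is the integral of `y ^ (n - 1) ∏ h_{β_j}(y q_j)` over `y > 0`. This is the density
of the proportions `X_j / (X_1 + ⋯ + X_n)` of independent variables `X_j` with densities `h_{β_j}`,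
written in terms of the proportions and the total `y` (`lintegral_jointPdf_mul`). Hence `Q_i` is
distributed as `X_i / (X_i + Z)` with `Z = ∑_{j ≠ i} X_j`. The `h_b` form a convolution family, so
`Z` has density `h_{s - b}`, where `b = β_i` and `s` is the sum of the `β_j`
(`lintegral_pi_mlMeasure_proportion`), and the same change of variables for the pair `(X_i, Z)`
gives the claimed density (`lintegral_marginalDensity`).

The analytic input concerns `h_b`.

* Termwise integration of the series gives its Laplace transform `(1 + s ^ ν) ^ (-b)` for `s > 1`
  (`laplace_mlDensity`). The convolution property follows, because the Laplace transform determines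
  a finite measure on `[0, ∞)` (`ext_of_laplace`).
* `(1 + s ^ ν) ^ (-b)` is completely monotone, because `ν ≤ 1`
  (`cmUpTo_rpow_mul_one_add_rpow`). By Post-Widder inversion a function with completely monotone
  Laplace transform is nonnegative (`nonneg_of_laplace_cm`), so `h_b ≥ 0`. Comparison of the Taylor
  series of the Laplace transform with its values near `0` gives `∫ h_b ≤ 1`.
* The function `νb ∫₀ˣ h_b - x h_b(x)` also has a completely monotone Laplace transform. So
  `x h_b(x) ≤ νb` (`mul_mlDensity_le`), which makes the integral defining the marginal density
  converge for every `q` in `(0, 1)`.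
-/

open Filter Topology
open scoped ENNReal

namespace FracDirichlet

/-! ### The Mittag-Leffler series -/

/-- The coefficient `Γ(b + r) / (r! Γ(b))` of the Mittag-Leffler series, which is the absolute
value of the binomial coefficient of `-b` over `r`. -/
noncomputable def risingCoeff (b : ℝ) (r : ℕ) : ℝ :=
  Real.Gamma (b + r) / (r.factorial * Real.Gamma b)

lemma risingCoeff_pos {b : ℝ} (hb : 0 < b) (r : ℕ) : 0 < risingCoeff b r := by
  unfold risingCoeff; positivity

lemma add_mul_risingCoeff {b : ℝ} (hb : 0 < b) (r : ℕ) :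
    (b + r) * risingCoeff b r = b * risingCoeff (b + 1) r := by
  unfold risingCoeff
  have h1 : Real.Gamma (b + 1 + r) = (b + r) * Real.Gamma (b + r) := by
    rw [add_right_comm, Real.Gamma_add_one (by positivity)]
  have := (Real.Gamma_pos_of_pos hb).ne'
  rw [h1, Real.Gamma_add_one hb.ne']
  field_simp

lemma risingCoeff_eq_multichoose {b : ℝ} (hb : 0 < b) (r : ℕ) :
    risingCoeff b r = Ring.multichoose b r := by
  have hG : Real.Gamma (b + r) = (ascPochhammer ℝ r).eval b * Real.Gamma b := by
    induction r with
    | zero => simp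
    | succ n ih =>
      rw [Nat.cast_succ, ← add_assoc, Real.Gamma_add_one (by positivity), ih,
        ascPochhammer_succ_eval]
      ring
  have h := Ring.factorial_nsmul_multichoose_eq_ascPochhammer b r
  rw [Polynomial.ascPochhammer_smeval_eq_eval, nsmul_eq_mul] at h
  have := (Real.Gamma_pos_of_pos hb).ne'
  rw [risingCoeff, hG, ← h]
  field_simp

lemma hasSum_risingCoeff {b : ℝ} (hb : 0 < b) {x : ℝ} (hx : |x| < 1) :
    HasSum (fun r => risingCoeff b r * x ^ r) ((1 - x) ^ (-b)) := by
  have hx' : x ∈ Metric.eball (0 : ℝ) 1 := by simpa [enorm_eq_nnnorm] using! hx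
  have h := (Real.one_div_one_sub_rpow_hasFPowerSeriesOnBall_zero b).hasSum hx'
  have h1 : (0 : ℝ) ≤ 1 - x := by linarith [(abs_lt.1 hx).2]
  simp only [zero_add, one_div, ← Real.rpow_neg h1] at h
  convert! h using 2 with r
  simp [FormalMultilinearSeries.ofScalars, risingCoeff_eq_multichoose hb, Ring.multichoose_eq]

/-- The right-hand side bounds the part of the Gamma integral over `(T, T + 1]`. -/
lemma rpow_le_exp_mul_Gamma {T a : ℝ} (hT : 0 < T) (ha : 0 ≤ a) :
    T ^ a ≤ Real.exp (T + 1) * Real.Gamma (a + 1) := by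
  have h1 : Real.exp (-(T + 1)) * T ^ a ≤ Real.Gamma (a + 1) := by
    rw [Real.Gamma_eq_integral (by positivity)]
    have hint := Real.GammaIntegral_convergent (s := a + 1) (by positivity)
    calc Real.exp (-(T + 1)) * T ^ a
        = ∫ _ in Ioc T (T + 1), Real.exp (-(T + 1)) * T ^ a := by simp
      _ ≤ ∫ x in Ioc T (T + 1), Real.exp (-x) * x ^ (a + 1 - 1) := by
        refine setIntegral_mono_on (integrableOn_const (by simp))
          (hint.mono_set fun x hx => hT.trans hx.1) measurableSet_Ioc fun x hx => ?_
        have hx1 := hx.1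
        have hx2 := hx.2
        rw [add_sub_cancel_right]
        gcongr
      _ ≤ _ := by
        refine setIntegral_mono_set hint ?_ (ae_of_all _ fun x hx => hT.trans hx.1)
        filter_upwards [ae_restrict_mem measurableSet_Ioi] with x hx
        have : (0 : ℝ) < x := hx
        simp only [Pi.zero_apply]
        positivity
  calc T ^ a = Real.exp (T + 1) * (Real.exp (-(T + 1)) * T ^ a) := by
        rw [← mul_assoc, ← Real.exp_add]; simp
    _ ≤ _ := by gcongr

lemma rpow_div_Gamma_le {t K a : ℝ} (ht : 0 < t) (hK : 0 < K) (ha : 0 < a) :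
    t ^ a / Real.Gamma a ≤ a * K ^ (-a) * Real.exp (K * t + 1) := by
  have h := rpow_le_exp_mul_Gamma (mul_pos hK ht) ha.le
  rw [Real.Gamma_add_one ha.ne', Real.mul_rpow hK.le ht.le] at h
  have hG := Real.Gamma_pos_of_pos ha
  have hKa := Real.rpow_pos_of_pos hK a
  rw [Real.rpow_neg hK.le, div_le_iff₀ hG]
  calc t ^ a = (K ^ a)⁻¹ * (K ^ a * t ^ a) := by field_simp
    _ ≤ (K ^ a)⁻¹ * (Real.exp (K * t + 1) * (a * Real.Gamma a)) := by gcongr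
    _ = _ := by ring

/-- A summable bound on the Mittag-Leffler series, uniform for `|z| ≤ t ^ ν`. -/
lemma norm_mittagLeffler_term_le {ν b t K z : ℝ} (hν : 0 < ν) (hb : 0 < b) (ht : 0 < t)
    (hK : 0 < K) (hz : |z| ≤ t ^ ν) (r : ℕ) :
    ‖z ^ r / Real.Gamma (ν * r + ν * b) * risingCoeff b r‖ ≤
      t ^ (-(ν * b)) * (ν * b * K ^ (-(ν * b)) * Real.exp (K * t + 1)) *
        (risingCoeff (b + 1) r * (K ^ (-ν)) ^ r) := by
  have hc := risingCoeff_pos hb r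
  have ha : 0 < ν * r + ν * b := by positivity
  have hG := Real.Gamma_pos_of_pos ha
  rw [norm_mul, norm_div, norm_pow, Real.norm_eq_abs, Real.norm_of_nonneg hG.le,
    Real.norm_of_nonneg hc.le]
  have h1 : |z| ^ r ≤ t ^ (-(ν * b)) * t ^ (ν * r + ν * b) := by
    rw [← Real.rpow_add ht, show -(ν * b) + (ν * r + ν * b) = ν * r by ring, Real.rpow_mul ht.le,
      Real.rpow_natCast]
    gcongr
  have hKr : K ^ (-(ν * r + ν * b)) = K ^ (-(ν * b)) * (K ^ (-ν)) ^ r := by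
    rw [← Real.rpow_natCast, ← Real.rpow_mul hK.le, ← Real.rpow_add hK]
    ring_nf
  calc |z| ^ r / Real.Gamma (ν * r + ν * b) * risingCoeff b r
      ≤ t ^ (-(ν * b)) * t ^ (ν * r + ν * b) / Real.Gamma (ν * r + ν * b) * risingCoeff b r := by
        gcongr
    _ = t ^ (-(ν * b)) * (t ^ (ν * r + ν * b) / Real.Gamma (ν * r + ν * b)) * risingCoeff b r := by
        ring
    _ ≤ t ^ (-(ν * b)) * ((ν * r + ν * b) * K ^ (-(ν * r + ν * b)) * Real.exp (K * t + 1)) *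
          risingCoeff b r := by
        gcongr
        exact rpow_div_Gamma_le ht hK ha
    _ = t ^ (-(ν * b)) * (ν * K ^ (-(ν * b)) * (K ^ (-ν)) ^ r * Real.exp (K * t + 1)) *
          ((b + r) * risingCoeff b r) := by rw [hKr]; ring
    _ = _ := by rw [add_mul_risingCoeff hb]; ring

lemma summable_risingCoeff_mul {ν b K : ℝ} (hν : 0 < ν) (hb : 0 < b) (hK : 1 < K) :
    Summable fun r => risingCoeff b r * (K ^ (-ν)) ^ r := by
  refine (hasSum_risingCoeff hb ?_).summable
  rw [abs_of_pos (by positivity)]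
  exact Real.rpow_lt_one_of_one_lt_of_neg hK (by linarith)

lemma continuous_mittagLeffler {ν b : ℝ} (hν : 0 < ν) (hb : 0 < b) :
    Continuous (mittagLeffler ν (ν * b) b) := by
  refine continuous_iff_continuousAt.2 fun z₀ => ?_
  have hR : 0 < |z₀| + 1 := by positivity
  refine ContinuousOn.continuousAt (s := Metric.ball 0 (|z₀| + 1)) ?_
    (Metric.isOpen_ball.mem_nhds (by simp))
  refine continuousOn_tsum (fun r => by fun_prop)
    ((summable_risingCoeff_mul hν (b := b + 1) (by positivity) one_lt_two).mul_left _)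
    (fun r z hz => norm_mittagLeffler_term_le hν hb (t := (|z₀| + 1) ^ ν⁻¹) (by positivity)
      two_pos ?_ r)
  rw [← Real.rpow_mul hR.le, inv_mul_cancel₀ hν.ne', Real.rpow_one]
  simpa using (Metric.mem_ball.1 hz).le

/-- The function `x ↦ x ^ (νb - 1) E^b_{ν,νb}(-x ^ ν)`, meaningful for `x > 0`. It is the density
of the (generalized) Mittag-Leffler distribution, and its Laplace transform is
`s ↦ (1 + s ^ ν) ^ (-b)`. -/
noncomputable def mlDensity (ν b x : ℝ) : ℝ :=
  x ^ (ν * b - 1) * mittagLeffler ν (ν * b) b (-(x ^ ν))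

lemma measurable_mlDensity {ν b : ℝ} (hν : 0 < ν) (hb : 0 < b) : Measurable (mlDensity ν b) := by
  have := (continuous_mittagLeffler hν hb).measurable
  unfold mlDensity
  fun_prop

lemma continuousAt_mlDensity {ν b x : ℝ} (hν : 0 < ν) (hb : 0 < b) (hx : 0 < x) :
    ContinuousAt (mlDensity ν b) x := by
  refine (Real.continuousAt_rpow_const _ _ (Or.inl hx.ne')).mul ?_
  exact (continuous_mittagLeffler hν hb).continuousAt.comp
    (f := fun x : ℝ => -(x ^ ν)) (Real.continuousAt_rpow_const _ _ (Or.inl hx.ne')).neg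

lemma exists_abs_mlDensity_le {ν b : ℝ} (hν : 0 < ν) (hb : 0 < b) :
    ∃ M, ∀ t, 0 < t → |mlDensity ν b t| ≤ M * t⁻¹ * Real.exp (2 * t) := by
  have hs := summable_risingCoeff_mul hν (b := b + 1) (by positivity) one_lt_two
  refine ⟨(ν * b * 2 ^ (-(ν * b)) * Real.exp 1) *
    ∑' r, risingCoeff (b + 1) r * (2 ^ (-ν)) ^ r, fun t ht => ?_⟩
  have hz : |-(t ^ ν)| ≤ t ^ ν := by rw [abs_neg, abs_of_pos (by positivity)]
  have h1 : |mittagLeffler ν (ν * b) b (-(t ^ ν))| ≤ _ :=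
    tsum_of_norm_bounded (hs.mul_left _).hasSum
      (fun r => norm_mittagLeffler_term_le hν hb ht two_pos hz r)
  rw [tsum_mul_left] at h1
  rw [mlDensity, abs_mul, abs_of_pos (by positivity : 0 < t ^ (ν * b - 1))]
  refine (mul_le_mul_of_nonneg_left h1 (by positivity)).trans (le_of_eq ?_)
  have : t ^ (ν * b - 1) * t ^ (-(ν * b)) = t⁻¹ := by
    rw [← Real.rpow_add ht, ← Real.rpow_neg_one]; ring_nf
  rw [Real.exp_add, ← this]
  ring

lemma integral_exp_mul_rpow_div_Gamma {a s : ℝ} (ha : 0 < a) (hs : 0 < s) :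
    ∫ t in Ioi (0 : ℝ), Real.exp (-(s * t)) * (t ^ (a - 1) / Real.Gamma a) = s ^ (-a) := by
  have h := Real.integral_rpow_mul_exp_neg_mul_Ioi ha hs
  have hG := (Real.Gamma_pos_of_pos ha).ne'
  rw [show (fun t : ℝ => Real.exp (-(s * t)) * (t ^ (a - 1) / Real.Gamma a)) =
    fun t => (Real.Gamma a)⁻¹ * (t ^ (a - 1) * Real.exp (-(s * t))) by ext; ring,
    integral_const_mul, h, one_div, Real.inv_rpow hs.le, Real.rpow_neg hs.le]
  field_simp

lemma integrableOn_exp_mul_rpow {a s : ℝ} (ha : 0 < a) (hs : 0 < s) :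
    IntegrableOn (fun t : ℝ => Real.exp (-(s * t)) * t ^ (a - 1)) (Ioi 0) := by
  have := integrableOn_rpow_mul_exp_neg_mul_rpow (p := 1) (s := a - 1) (by linarith) one_pos hs
  refine this.congr_fun (fun t ht => ?_) measurableSet_Ioi
  simp only [Real.rpow_one]
  rw [mul_comm, neg_mul]

/-- The Laplace transform of `mlDensity`, obtained by termwise integration of the series; the
resulting binomial series converges only for `s > 1`. -/
lemma laplace_mlDensity {ν b s : ℝ} (hν : 0 < ν) (hb : 0 < b) (hs : 1 < s) :
    IntegrableOn (fun t => Real.exp (-(s * t)) * mlDensity ν b t) (Ioi 0) ∧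
      ∫ t in Ioi (0 : ℝ), Real.exp (-(s * t)) * mlDensity ν b t = (1 + s ^ ν) ^ (-b) := by
  have hs0 : 0 < s := by linarith
  set F : ℕ → ℝ → ℝ := fun r t => (-1) ^ r * risingCoeff b r *
    (Real.exp (-(s * t)) * (t ^ (ν * r + ν * b - 1) / Real.Gamma (ν * r + ν * b))) with hF
  have ha (r : ℕ) : 0 < ν * r + ν * b := by positivity
  have hint (r : ℕ) : IntegrableOn (F r) (Ioi 0) := by
    refine Integrable.const_mul ?_ _
    simp only [← mul_div_assoc]
    exact (integrableOn_exp_mul_rpow (ha r) hs0).div_const _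
  have hspow (r : ℕ) : s ^ (-(ν * r + ν * b)) = s ^ (-(ν * b)) * (s ^ (-ν)) ^ r := by
    rw [← Real.rpow_natCast, ← Real.rpow_mul hs0.le, ← Real.rpow_add hs0]
    ring_nf
  have hnorm (r : ℕ) : ∫ t in Ioi (0 : ℝ), ‖F r t‖ =
      s ^ (-(ν * b)) * (risingCoeff b r * (s ^ (-ν)) ^ r) := by
    have : ∫ t in Ioi (0 : ℝ), ‖F r t‖ = ∫ t in Ioi (0 : ℝ), risingCoeff b r *
        (Real.exp (-(s * t)) * (t ^ (ν * r + ν * b - 1) / Real.Gamma (ν * r + ν * b))) := by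
      refine setIntegral_congr_fun measurableSet_Ioi fun t ht => ?_
      have ht : (0 : ℝ) < t := ht
      have h1 := risingCoeff_pos hb r
      have h2 := Real.Gamma_pos_of_pos (ha r)
      simp only [hF, norm_mul, norm_pow, norm_neg, norm_one, one_pow, one_mul]
      rw [Real.norm_of_nonneg h1.le, Real.norm_of_nonneg (Real.exp_pos _).le,
        Real.norm_of_nonneg (by positivity)]
    rw [this, integral_const_mul, integral_exp_mul_rpow_div_Gamma (ha r) hs0, hspow]
    ring
  have hsum : Summable fun r => ∫ t in Ioi (0 : ℝ), ‖F r t‖ := by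
    simp only [hnorm]
    exact (summable_risingCoeff_mul hν hb hs).mul_left _
  have hterm (t : ℝ) (ht : 0 < t) :
      HasSum (fun r => F r t) (Real.exp (-(s * t)) * mlDensity ν b t) := by
    have hz : |-(t ^ ν)| ≤ t ^ ν := by rw [abs_neg, abs_of_pos (by positivity)]
    have h1 : Summable fun r : ℕ =>
        (-(t ^ ν)) ^ r / Real.Gamma (ν * r + ν * b) * risingCoeff b r :=
      Summable.of_norm_bounded
        ((summable_risingCoeff_mul hν (b := b + 1) (by positivity) one_lt_two).mul_left _)
        (fun r => norm_mittagLeffler_term_le hν hb ht two_pos hz r)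
    have h2 := (h1.hasSum.mul_left (t ^ (ν * b - 1))).mul_left (Real.exp (-(s * t)))
    refine h2.congr_fun fun r => ?_
    have : t ^ (ν * r + ν * b - 1) = t ^ (ν * b - 1) * (t ^ ν) ^ r := by
      rw [← Real.rpow_natCast, ← Real.rpow_mul ht.le, ← Real.rpow_add ht]
      ring_nf
    simp only [hF]
    rw [this, neg_pow]
    ring
  have hcongr : EqOn (fun t => ∑' r, F r t)
      (fun t => Real.exp (-(s * t)) * mlDensity ν b t) (Ioi 0) :=
    fun t ht => (hterm t ht).tsum_eq
  have hval : ∫ t in Ioi (0 : ℝ), Real.exp (-(s * t)) * mlDensity ν b t = (1 + s ^ ν) ^ (-b) := by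
    rw [← setIntegral_congr_fun measurableSet_Ioi hcongr]
    have h1 := hasSum_integral_of_summable_integral_norm hint hsum
    have hlt : |-(s ^ (-ν))| < 1 := by
      rw [abs_neg, abs_of_pos (by positivity)]
      exact Real.rpow_lt_one_of_one_lt_of_neg hs (by linarith)
    have h2 := (hasSum_risingCoeff hb hlt).mul_left (s ^ (-(ν * b)))
    have h3 (r : ℕ) : ∫ t in Ioi (0 : ℝ), F r t =
        s ^ (-(ν * b)) * (risingCoeff b r * (-(s ^ (-ν))) ^ r) := by
      simp only [hF]
      rw [integral_const_mul, integral_exp_mul_rpow_div_Gamma (ha r) hs0, hspow, neg_pow (s ^ (-ν))]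
      ring
    simp only [h3] at h1
    rw [h1.unique h2, sub_neg_eq_add, show -(ν * b) = ν * (-b) by ring, Real.rpow_mul hs0.le,
      ← Real.mul_rpow (by positivity) (by positivity)]
    congr 1
    rw [mul_add, ← Real.rpow_add hs0]
    simp [add_comm]
  -- The Bochner integral is nonzero, so the integrand is integrable.
  refine ⟨?_, hval⟩
  by_contra h
  rw [integral_undef h] at hval
  have : 0 < (1 + s ^ ν) ^ (-b) := by positivity
  exact this.ne hval

/-! ### Completely monotone functions -/

/-- Complete monotonicity of order `n` on `(0, ∞)`: `f`, `-f'`, …, `(-1) ^ n f^(n)` exist and are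
nonnegative there. -/
def CMUpTo : ℕ → (ℝ → ℝ) → Prop
  | 0, f => ∀ s, 0 < s → 0 ≤ f s
  | n + 1, f => (∀ s, 0 < s → 0 ≤ f s) ∧
      ∃ g : ℝ → ℝ, (∀ s, 0 < s → HasDerivAt f (-g s) s) ∧ CMUpTo n g

lemma CMUpTo.nonneg {n : ℕ} {f : ℝ → ℝ} (h : CMUpTo n f) {s : ℝ} (hs : 0 < s) : 0 ≤ f s := by
  cases n with
  | zero => exact h s hs
  | succ n => exact h.1 s hs

lemma CMUpTo.linear_comb {n : ℕ} {f g : ℝ → ℝ} (hf : CMUpTo n f) (hg : CMUpTo n g) {a b : ℝ}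
    (ha : 0 ≤ a) (hb : 0 ≤ b) : CMUpTo n (fun s => a * f s + b * g s) := by
  have h0 : ∀ s, 0 < s → 0 ≤ a * f s + b * g s := fun s hs =>
    add_nonneg (mul_nonneg ha (hf.nonneg hs)) (mul_nonneg hb (hg.nonneg hs))
  induction n generalizing f g with
  | zero => exact h0
  | succ n ih =>
    obtain ⟨-, f', hf', hf''⟩ := hf
    obtain ⟨-, g', hg', hg''⟩ := hg
    refine ⟨h0, fun s => a * f' s + b * g' s, fun s hs => ?_, ih hf'' hg'' fun s hs =>
      add_nonneg (mul_nonneg ha (hf''.nonneg hs)) (mul_nonneg hb (hg''.nonneg hs))⟩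
    refine (((hf' s hs).const_mul a).add ((hg' s hs).const_mul b)).congr_deriv ?_
    ring

lemma CMUpTo.const_mul {n : ℕ} {f : ℝ → ℝ} (hf : CMUpTo n f) {a : ℝ} (ha : 0 ≤ a) :
    CMUpTo n (fun s => a * f s) := by
  simpa using hf.linear_comb hf ha le_rfl

/-- The functions `s ↦ s ^ (-a) (1 + s ^ ν) ^ (-c)` with `a, c ≥ 0` are completely monotone when
`0 < ν ≤ 1`, since the cone they generate is stable under `f ↦ -f'`. -/
lemma cmUpTo_rpow_mul_one_add_rpow {ν : ℝ} (hν0 : 0 < ν) (hν1 : ν ≤ 1) (n : ℕ) {a c : ℝ}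
    (ha : 0 ≤ a) (hc : 0 ≤ c) : CMUpTo n (fun s => s ^ (-a) * (1 + s ^ ν) ^ (-c)) := by
  induction n generalizing a c with
  | zero => intro s hs; positivity
  | succ n ih =>
    refine ⟨fun s hs => by positivity, _, fun s hs => ?_,
      (ih (a := a + 1) (c := c) (by linarith) hc).linear_comb
        (ih (a := a + 1 - ν) (c := c + 1) (by linarith) (by linarith)) ha (mul_nonneg hc hν0.le)⟩
    have h1 : HasDerivAt (fun s : ℝ => s ^ (-a)) (-a * s ^ (-a - 1)) s :=
      Real.hasDerivAt_rpow_const (Or.inl hs.ne')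
    have h2 : HasDerivAt (fun s : ℝ => 1 + s ^ ν) (ν * s ^ (ν - 1)) s :=
      (Real.hasDerivAt_rpow_const (Or.inl hs.ne')).const_add 1
    have h3 := h2.rpow_const (p := -c) (Or.inl (by positivity))
    refine (h1.mul h3).congr_deriv ?_
    have e1 : s ^ (-(a + 1 - ν)) = s ^ (-a) * s ^ (ν - 1) := by
      rw [← Real.rpow_add hs]; ring_nf
    rw [e1, show -(a + 1) = -a - 1 by ring, show -(c + 1) = -c - 1 by ring]
    ring

/-! ### Laplace transforms -/

lemma hasDerivAt_laplace {f : ℝ → ℝ} {s₀ : ℝ} (hf : Measurable f)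
    (hint : ∀ s, s₀ < s → IntegrableOn (fun t => Real.exp (-(s * t)) * f t) (Ioi 0))
    {s : ℝ} (hs : s₀ < s) :
    IntegrableOn (fun t => Real.exp (-(s * t)) * (t * f t)) (Ioi 0) ∧
      HasDerivAt (fun s => ∫ t in Ioi (0 : ℝ), Real.exp (-(s * t)) * f t)
        (-∫ t in Ioi (0 : ℝ), Real.exp (-(s * t)) * (t * f t)) s := by
  obtain ⟨d, hd, hds⟩ : ∃ d > 0, s₀ < s - 2 * d := ⟨(s - s₀) / 3, by linarith, by linarith⟩
  have key := hasDerivAt_integral_of_dominated_loc_of_deriv_le (μ := volume.restrict (Ioi (0 : ℝ)))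
    (F := fun s t => Real.exp (-(s * t)) * f t)
    (F' := fun s t => -(Real.exp (-(s * t)) * (t * f t))) (x₀ := s)
    (bound := fun t => d⁻¹ * ‖Real.exp (-((s - 2 * d) * t)) * f t‖)
    (s := Metric.ball s d) (Metric.ball_mem_nhds s hd)
    (Eventually.of_forall fun x => by fun_prop) (hint s hs) (by fun_prop) ?_
    ((hint _ hds).norm.const_mul _) ?_
  · rw [integral_neg] at key
    exact ⟨by simpa [IntegrableOn] using key.1.neg, key.2⟩
  · filter_upwards [ae_restrict_mem measurableSet_Ioi] with t ht x hx
    have ht : 0 < t := ht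
    have hx : s - d < x := by
      have := (abs_lt.1 (by simpa [Real.dist_eq] using hx : |x - s| < d)).1
      linarith
    have h1 : d * t ≤ Real.exp (d * t) := by linarith [Real.add_one_le_exp (d * t)]
    have h2 : Real.exp (-(x * t)) * t ≤ d⁻¹ * Real.exp (-((s - 2 * d) * t)) := by
      calc Real.exp (-(x * t)) * t = d⁻¹ * (Real.exp (-(x * t)) * (d * t)) := by field_simp
        _ ≤ d⁻¹ * (Real.exp (-((s - d) * t)) * Real.exp (d * t)) := by gcongr
        _ = _ := by rw [← Real.exp_add]; ring_nf
    rw [norm_neg, ← mul_assoc, norm_mul, norm_mul _ (f t), ← mul_assoc]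
    refine mul_le_mul_of_nonneg_right ?_ (norm_nonneg _)
    rw [Real.norm_of_nonneg (by positivity), Real.norm_of_nonneg (Real.exp_pos _).le]
    exact h2
  · refine ae_of_all _ fun t x _ => ?_
    have h1 : HasDerivAt (fun x : ℝ => -(x * t)) (-t) x := (hasDerivAt_mul_const t).neg
    refine (h1.exp.mul_const (f t)).congr_deriv ?_
    ring

/-- If `f` has Laplace transform `F` on `(s₀, ∞)`, then `t f(t)` has Laplace transform `-F'`. -/
lemma neg_deriv_eq_laplace {f F G : ℝ → ℝ} {s₀ : ℝ} (hs₀ : 0 ≤ s₀) (hf : Measurable f)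
    (hint : ∀ s, s₀ < s → IntegrableOn (fun t => Real.exp (-(s * t)) * f t) (Ioi 0))
    (hF : ∀ s, s₀ < s → ∫ t in Ioi (0 : ℝ), Real.exp (-(s * t)) * f t = F s)
    (hG : ∀ s, 0 < s → HasDerivAt F (-G s) s) {s : ℝ} (hs : s₀ < s) :
    ∫ t in Ioi (0 : ℝ), Real.exp (-(s * t)) * (t * f t) = G s := by
  have h1 := (hasDerivAt_laplace hf hint hs).2
  have h2 := (hG s (hs₀.trans_lt hs)).congr_of_eventuallyEq
    (eventually_of_mem (Ioi_mem_nhds hs) hF)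
  exact neg_injective (h1.unique h2)

/-- The integral is `(-1) ^ n` times the `n`-th derivative of `F` at `s`. -/
lemma laplace_pow_mul_nonneg {f F : ℝ → ℝ} {s₀ : ℝ} (n : ℕ) (hs₀ : 0 ≤ s₀) (hf : Measurable f)
    (hint : ∀ s, s₀ < s → IntegrableOn (fun t => Real.exp (-(s * t)) * f t) (Ioi 0))
    (hF : ∀ s, s₀ < s → ∫ t in Ioi (0 : ℝ), Real.exp (-(s * t)) * f t = F s)
    (hCM : CMUpTo n F) {s : ℝ} (hs : s₀ < s) :
    0 ≤ ∫ t in Ioi (0 : ℝ), Real.exp (-(s * t)) * (t ^ n * f t) := by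
  induction n generalizing f F with
  | zero => simpa [hF s hs] using hCM.nonneg (hs₀.trans_lt hs)
  | succ n ih =>
    obtain ⟨-, G, hG, hGn⟩ := hCM
    have := ih (f := fun t => t * f t) (by fun_prop)
      (fun s hs => (hasDerivAt_laplace hf hint hs).1)
      (fun s hs => neg_deriv_eq_laplace hs₀ hf hint hF hG hs) hGn
    simpa only [pow_succ, mul_assoc] using this

/-- The Taylor polynomials at `s` of a completely monotone function lie below the function to the
left of `s`. When the function agrees near `s` with the Laplace transform of `f`, the Taylor
coefficients are the integrals of `t ^ k e ^ (-st) f(t)`. -/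
lemma sum_laplace_pow_mul_le {f F : ℝ → ℝ} {s₀ : ℝ} (n : ℕ) (hs₀ : 0 ≤ s₀) (hf : Measurable f)
    (hint : ∀ s, s₀ < s → IntegrableOn (fun t => Real.exp (-(s * t)) * f t) (Ioi 0))
    (hF : ∀ s, s₀ < s → ∫ t in Ioi (0 : ℝ), Real.exp (-(s * t)) * f t = F s)
    (hCM : CMUpTo n F) {s w : ℝ} (hs : s₀ < s) (hw0 : 0 ≤ w) (hw : w < s) :
    ∑ k ∈ Finset.range n, w ^ k / k.factorial *
      ∫ t in Ioi (0 : ℝ), Real.exp (-(s * t)) * (t ^ k * f t) ≤ F (s - w) := by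
  induction n generalizing f F w with
  | zero => simpa using hCM.nonneg (sub_pos.2 hw)
  | succ n ih =>
    obtain ⟨-, G, hG, hGn⟩ := hCM
    set I : ℕ → ℝ := fun k => ∫ t in Ioi (0 : ℝ), Real.exp (-(s * t)) * (t ^ k * f t) with hI
    have hstep (w : ℝ) (hw0 : 0 ≤ w) (hw : w < s) :
        ∑ k ∈ Finset.range n, w ^ k / k.factorial * I (k + 1) ≤ G (s - w) := by
      have := ih (f := fun t => t * f t) (by fun_prop)
        (fun s hs => (hasDerivAt_laplace hf hint hs).1)
        (fun s hs => neg_deriv_eq_laplace hs₀ hf hint hF hG hs) hGn hw0 hw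
      simpa only [hI, pow_succ, mul_assoc] using this
    set R : ℝ → ℝ := fun w => F (s - w) - ∑ k ∈ Finset.range (n + 1), w ^ k / k.factorial * I k
      with hR
    have hder (v : ℝ) (hv : v < s) : HasDerivAt R
        (G (s - v) - ∑ k ∈ Finset.range n, v ^ k / k.factorial * I (k + 1)) v := by
      have h1 : HasDerivAt (fun w => F (s - w)) (G (s - v)) v := by
        have := (hG (s - v) (sub_pos.2 hv)).comp v ((hasDerivAt_id v).const_sub s)
        simpa [Function.comp_def] using this
      refine h1.sub ?_
      have h2 : HasDerivAt (fun w => ∑ k ∈ Finset.range (n + 1), w ^ k / k.factorial * I k)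
          (∑ k ∈ Finset.range (n + 1), k * v ^ (k - 1) / k.factorial * I k) v := by
        refine HasDerivAt.fun_sum fun k _ => ?_
        exact ((hasDerivAt_pow k v).div_const _).mul_const _
      refine h2.congr_deriv ?_
      rw [Finset.sum_range_succ']
      simp only [Nat.cast_zero, zero_mul, zero_div, add_zero]
      refine Finset.sum_congr rfl fun k _ => ?_
      rw [Nat.factorial_succ, Nat.add_sub_cancel]
      push_cast
      field_simp
    have hmono : MonotoneOn R (Ico 0 s) := by
      refine monotoneOn_of_deriv_nonneg (convex_Ico 0 s)
        (fun v hv => (hder v hv.2).continuousAt.continuousWithinAt)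
        (fun v hv => ?_) fun v hv => ?_
      · rw [interior_Ico] at hv
        exact (hder v hv.2).differentiableAt.differentiableWithinAt
      · rw [interior_Ico] at hv
        rw [(hder v hv.2).deriv]
        exact sub_nonneg.2 (hstep v hv.1.le hv.2)
    have h0 : R 0 = 0 := by
      simp only [hR, sub_zero, Finset.sum_range_succ']
      simp [hI, hF s hs]
    have := hmono ⟨le_rfl, hw0.trans_lt hw⟩ ⟨hw0, hw⟩ hw0
    rw [h0] at this
    exact sub_nonneg.1 this

lemma integral_exp_mul_pow {s : ℝ} (hs : 0 < s) (n : ℕ) :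
    ∫ t in Ioi (0 : ℝ), Real.exp (-(s * t)) * t ^ n = n.factorial / s ^ (n + 1) := by
  have h := integral_exp_mul_rpow_div_Gamma (a := n + 1) (by positivity) hs
  simp only [← mul_div_assoc, integral_div, add_sub_cancel_right, Real.rpow_natCast,
    Real.Gamma_nat_eq_factorial] at h
  rw [div_eq_iff (by positivity), Real.rpow_neg hs.le] at h
  rw [h, ← Nat.cast_succ, Real.rpow_natCast]
  field_simp

lemma integrableOn_exp_mul_pow {s : ℝ} (hs : 0 < s) (n : ℕ) :
    IntegrableOn (fun t => Real.exp (-(s * t)) * t ^ n) (Ioi 0) := by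
  have h := integrableOn_exp_mul_rpow (a := n + 1) (by positivity) hs
  simpa only [add_sub_cancel_right, Real.rpow_natCast] using h

/-- Positivity by Post-Widder inversion: if all averages of `p` against the Gamma densities are
nonnegative, then `p` is nonnegative at its points of continuity. -/
lemma nonneg_of_gamma_averages_nonneg {p : ℝ → ℝ} {x M : ℝ} (hx : 0 < x) (hp : ContinuousAt p x)
    (hm : Measurable p) (hb : ∀ t, 0 < t → |p t| ≤ M * t⁻¹)
    (h : ∀ (n : ℕ) (s : ℝ), 0 < s →
      0 ≤ ∫ t in Ioi (0 : ℝ), Real.exp (-(s * t)) * (t ^ n * p t)) : 0 ≤ p x := by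
  by_contra! hneg
  obtain ⟨ε, hε, hεp⟩ : ∃ ε > 0, p x < -ε := ⟨-p x / 2, by linarith, by linarith⟩
  obtain ⟨δ, hδ, hδp⟩ := Metric.eventually_nhds_iff.1 (hp.eventually_lt continuousAt_const hεp)
  have hM : 0 ≤ M := by
    have := (abs_nonneg _).trans (hb x hx)
    exact nonneg_of_mul_nonneg_left this (by positivity)
  set C : ℝ := (M + ε * x) / δ ^ 2 + ε / δ with hC
  have hC0 : 0 ≤ C := by positivity
  -- `(t - x) ^ 2 / t` has Gamma averages tending to `0`, so this bound makes those of `p` negative.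
  have hle (t : ℝ) (ht : 0 < t) : p t ≤ -ε + C * ((t - x) ^ 2 / t) := by
    rcases lt_or_ge |t - x| δ with h1 | h1
    · have h2 := hδp (by simpa [Real.dist_eq] using h1 : dist t x < δ)
      have h3 : 0 ≤ C * ((t - x) ^ 2 / t) := by positivity
      linarith
    · have h2 := (le_abs_self _).trans (hb t ht)
      have h3 : M + ε * t ≤ C * (t - x) ^ 2 := by
        have h4 : (M + ε * x) ≤ (M + ε * x) / δ ^ 2 * (t - x) ^ 2 := by
          rw [div_mul_eq_mul_div, le_div_iff₀ (by positivity), ← sq_abs (t - x)]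
          gcongr
        have h5 : ε * (t - x) ≤ ε / δ * (t - x) ^ 2 := by
          rw [div_mul_eq_mul_div, le_div_iff₀ hδ, ← sq_abs (t - x), mul_assoc, pow_two]
          gcongr
          exact le_abs_self _
        rw [hC]
        linarith
      have h4 : C * ((t - x) ^ 2 / t) = C * (t - x) ^ 2 / t := by ring
      rw [h4]
      have h5 : M * t⁻¹ + ε ≤ C * (t - x) ^ 2 / t := by
        rw [le_div_iff₀ ht]
        calc (M * t⁻¹ + ε) * t = M + ε * t := by field_simp
          _ ≤ _ := h3
      linarith
  -- For the Gamma density with shape `n + 2` and rate `(n + 1) / x`, the average of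
  -- `(t - x) ^ 2 / t` is exactly `x / (n + 1)`.
  obtain ⟨n, hn⟩ := exists_nat_gt (C * x / ε)
  set s : ℝ := (n + 1) / x with hs
  have hs0 : 0 < s := by positivity
  have hi := integrableOn_exp_mul_pow hs0
  have hle2 : ∫ t in Ioi (0 : ℝ), Real.exp (-(s * t)) * (t ^ (n + 1) * p t) ≤
      ∫ t in Ioi (0 : ℝ), ((-ε - 2 * x * C) * (Real.exp (-(s * t)) * t ^ (n + 1)) +
        C * (Real.exp (-(s * t)) * t ^ (n + 2)) + C * x ^ 2 * (Real.exp (-(s * t)) * t ^ n)) := by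
    refine setIntegral_mono_on ?_ ((((hi _).const_mul _).add ((hi _).const_mul _)).add
      ((hi _).const_mul _)) measurableSet_Ioi fun t ht => ?_
    · refine ((hi n).const_mul M).mono' (by fun_prop) ?_
      filter_upwards [ae_restrict_mem measurableSet_Ioi] with t ht
      have ht : 0 < t := ht
      rw [norm_mul, norm_mul, Real.norm_of_nonneg (Real.exp_pos _).le,
        Real.norm_of_nonneg (by positivity : 0 ≤ t ^ (n + 1))]
      calc Real.exp (-(s * t)) * (t ^ (n + 1) * ‖p t‖)
          ≤ Real.exp (-(s * t)) * (t ^ (n + 1) * (M * t⁻¹)) := by gcongr; exact hb t ht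
        _ = _ := by rw [pow_succ]; field_simp
    · have ht : 0 < t := ht
      calc Real.exp (-(s * t)) * (t ^ (n + 1) * p t)
          ≤ Real.exp (-(s * t)) * (t ^ (n + 1) * (-ε + C * ((t - x) ^ 2 / t))) := by
            gcongr; exact hle t ht
        _ = _ := by field_simp; ring
  have heq : ∫ t in Ioi (0 : ℝ), ((-ε - 2 * x * C) * (Real.exp (-(s * t)) * t ^ (n + 1)) +
        C * (Real.exp (-(s * t)) * t ^ (n + 2)) + C * x ^ 2 * (Real.exp (-(s * t)) * t ^ n)) =
      (n + 1).factorial / s ^ (n + 2) * (-ε + C * (x / (n + 1))) := by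
    have hadd : IntegrableOn (fun t => (-ε - 2 * x * C) * (Real.exp (-(s * t)) * t ^ (n + 1)) +
        C * (Real.exp (-(s * t)) * t ^ (n + 2))) (Ioi 0) :=
      ((hi _).const_mul _).add ((hi _).const_mul _)
    rw [integral_add hadd ((hi _).const_mul _),
      integral_add ((hi _).const_mul _) ((hi _).const_mul _), integral_const_mul,
      integral_const_mul, integral_const_mul, integral_exp_mul_pow hs0, integral_exp_mul_pow hs0,
      integral_exp_mul_pow hs0, Nat.factorial_succ (n + 1), Nat.factorial_succ n]
    have hxs : x = (n + 1) / s := by rw [hs]; field_simp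
    clear_value C s
    rw [hxs]
    push_cast
    field_simp
    ring
  have h0 := (h (n + 1) s hs0).trans (hle2.trans_eq heq)
  have h1 : C * (x / (n + 1)) < ε := by
    rw [div_lt_iff₀ hε] at hn
    rw [← mul_div_assoc, div_lt_iff₀ (by positivity)]
    nlinarith
  have h2 : (n + 1).factorial / s ^ (n + 2) * (-ε + C * (x / (n + 1))) < 0 :=
    mul_neg_of_pos_of_neg (by positivity) (by linarith)
  linarith

/-- A function whose Laplace transform is completely monotone is nonnegative. -/
lemma nonneg_of_laplace_cm {f F : ℝ → ℝ} {K M x : ℝ} (hK : 1 ≤ K) (hx : 0 < x)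
    (hf : Measurable f) (hcont : ContinuousAt f x)
    (hb : ∀ t, 0 < t → |f t| ≤ M * t⁻¹ * Real.exp (K * t))
    (hint : ∀ s, 1 < s → IntegrableOn (fun t => Real.exp (-(s * t)) * f t) (Ioi 0))
    (hF : ∀ s, 1 < s → ∫ t in Ioi (0 : ℝ), Real.exp (-(s * t)) * f t = F s)
    (hCM : ∀ n, CMUpTo n F) : 0 ≤ f x := by
  -- The factor `e ^ (-Kt)` removes the exponential growth and shifts the Laplace transform by `K`.
  have h := nonneg_of_gamma_averages_nonneg (p := fun t => Real.exp (-(K * t)) * f t) (M := M) hx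
    (by fun_prop) (by fun_prop) (fun t ht => ?_) (fun n s hs => ?_)
  · exact nonneg_of_mul_nonneg_right h (Real.exp_pos _)
  · rw [abs_mul, abs_of_pos (Real.exp_pos _), Real.exp_neg, inv_mul_le_iff₀ (Real.exp_pos _),
      mul_comm]
    exact hb t ht
  · refine (laplace_pow_mul_nonneg n zero_le_one hf hint hF (hCM n)
      (s := s + K) (by linarith)).trans_eq (integral_congr_ae (ae_of_all _ fun t => ?_))
    have : Real.exp (-((s + K) * t)) = Real.exp (-(s * t)) * Real.exp (-(K * t)) := by
      rw [← Real.exp_add]; ring_nf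
    simp only [this]
    ring

/-! ### Positivity, total mass and decay of the Mittag-Leffler densities -/

lemma cmUpTo_one_add_rpow {ν b : ℝ} (hν0 : 0 < ν) (hν1 : ν ≤ 1) (hb : 0 ≤ b) (n : ℕ) :
    CMUpTo n (fun s => (1 + s ^ ν) ^ (-b)) := by
  simpa using cmUpTo_rpow_mul_one_add_rpow hν0 hν1 n (a := 0) (c := b) le_rfl hb

lemma mlDensity_nonneg {ν b x : ℝ} (hν0 : 0 < ν) (hν1 : ν ≤ 1) (hb : 0 < b) (hx : 0 < x) :
    0 ≤ mlDensity ν b x := by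
  obtain ⟨M, hM⟩ := exists_abs_mlDensity_le hν0 hb
  exact nonneg_of_laplace_cm one_le_two hx (measurable_mlDensity hν0 hb)
    (continuousAt_mlDensity hν0 hb hx) hM (fun s hs => (laplace_mlDensity hν0 hb hs).1)
    (fun s hs => (laplace_mlDensity hν0 hb hs).2) (cmUpTo_one_add_rpow hν0 hν1 hb.le)

lemma integrableOn_laplace_pow_mul {f : ℝ → ℝ} {s₀ : ℝ} (n : ℕ) (hf : Measurable f)
    (hint : ∀ s, s₀ < s → IntegrableOn (fun t => Real.exp (-(s * t)) * f t) (Ioi 0))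
    {s : ℝ} (hs : s₀ < s) :
    IntegrableOn (fun t => Real.exp (-(s * t)) * (t ^ n * f t)) (Ioi 0) := by
  induction n generalizing f with
  | zero => simpa using hint s hs
  | succ n ih =>
    have := ih (f := fun t => t * f t) (by fun_prop)
      (fun s hs => (hasDerivAt_laplace hf hint hs).1)
    simpa only [pow_succ, mul_assoc] using this

/-- The formula for the Laplace transform of `mlDensity` is available only for `s > 1`, so one
cannot let `s → 0` in it. Instead, the Taylor polynomials at `2` of `F(s) = (1 + s ^ ν) ^ (-b)` are
bounded at `2 - w` by `F(2 - w) ≤ 1`, and for `w = 2` they increase to the total mass. -/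
lemma lintegral_mlDensity_le_one {ν b : ℝ} (hν0 : 0 < ν) (hν1 : ν ≤ 1) (hb : 0 < b) :
    ∫⁻ t in Ioi (0 : ℝ), ENNReal.ofReal (mlDensity ν b t) ≤ 1 := by
  have hm := measurable_mlDensity hν0 hb
  have hint (s : ℝ) (hs : 1 < s) := (laplace_mlDensity hν0 hb hs).1
  have hL (s : ℝ) (hs : 1 < s) := (laplace_mlDensity hν0 hb hs).2
  have hCM := cmUpTo_one_add_rpow hν0 hν1 hb.le
  set I : ℕ → ℝ := fun k => ∫ t in Ioi (0 : ℝ),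
    Real.exp (-(2 * t)) * (t ^ k * mlDensity ν b t) with hI
  have hI0 (k : ℕ) : 0 ≤ I k := laplace_pow_mul_nonneg k zero_le_one hm hint hL (hCM k) one_lt_two
  have hsum (n : ℕ) : ∑ k ∈ Finset.range n, 2 ^ k / k.factorial * I k ≤ (1 : ℝ) := by
    have hcont : Continuous fun w : ℝ => ∑ k ∈ Finset.range n, w ^ k / k.factorial * I k := by
      fun_prop
    refine le_of_tendsto ((hcont.tendsto 2).mono_left (nhdsWithin_le_nhds (s := Iio 2))) ?_
    filter_upwards [Ico_mem_nhdsLT (zero_lt_two (α := ℝ))] with w hw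
    refine (sum_laplace_pow_mul_le n zero_le_one hm hint hL (hCM n) one_lt_two hw.1 hw.2).trans ?_
    have : 0 ≤ (2 - w) ^ ν := Real.rpow_nonneg (by linarith [hw.2]) ν
    exact Real.rpow_le_one_of_one_le_of_nonpos (by linarith) (by linarith)
  have hterm (t : ℝ) (ht : t ∈ Ioi (0 : ℝ)) : ENNReal.ofReal (mlDensity ν b t) =
      ∑' k : ℕ, ENNReal.ofReal (2 ^ k / k.factorial *
        (Real.exp (-(2 * t)) * (t ^ k * mlDensity ν b t))) := by
    have ht : 0 < t := ht
    have h0 := mlDensity_nonneg hν0 hν1 hb ht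
    have h1 : HasSum (fun k : ℕ => (2 * t) ^ k / k.factorial) (Real.exp (2 * t)) := by
      rw [Real.exp_eq_exp_ℝ]
      exact NormedSpace.expSeries_div_hasSum_exp (2 * t)
    have h2 := h1.mul_right (Real.exp (-(2 * t)) * mlDensity ν b t)
    rw [← mul_assoc, ← Real.exp_add, add_neg_cancel, Real.exp_zero, one_mul] at h2
    have h3 : HasSum (fun k : ℕ => 2 ^ k / k.factorial *
        (Real.exp (-(2 * t)) * (t ^ k * mlDensity ν b t))) (mlDensity ν b t) := by
      refine h2.congr_fun fun k => ?_
      rw [mul_pow]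
      ring
    rw [← ENNReal.ofReal_tsum_of_nonneg (fun k => by positivity) h3.summable, h3.tsum_eq]
  rw [setLIntegral_congr_fun measurableSet_Ioi hterm,
    lintegral_tsum fun k => by fun_prop]
  refine ENNReal.tsum_le_of_sum_range_le fun n => ?_
  have hk (k : ℕ) : ∫⁻ t in Ioi (0 : ℝ), ENNReal.ofReal (2 ^ k / k.factorial *
        (Real.exp (-(2 * t)) * (t ^ k * mlDensity ν b t))) =
      ENNReal.ofReal (2 ^ k / k.factorial * I k) := by
    rw [hI, ← integral_const_mul, ofReal_integral_eq_lintegral_ofReal]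
    · exact (integrableOn_laplace_pow_mul k hm hint one_lt_two).const_mul _
    · filter_upwards [ae_restrict_mem measurableSet_Ioi] with t ht
      have ht : 0 < t := ht
      have h0 := mlDensity_nonneg hν0 hν1 hb ht
      simp only [Pi.zero_apply]
      positivity
  simp only [hk]
  rw [← ENNReal.ofReal_sum_of_nonneg fun k _ => mul_nonneg (by positivity) (hI0 k)]
  exact ENNReal.ofReal_le_one.2 (hsum n)

lemma integrableOn_mlDensity {ν b : ℝ} (hν0 : 0 < ν) (hν1 : ν ≤ 1) (hb : 0 < b) :
    IntegrableOn (mlDensity ν b) (Ioi 0) := by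
  refine ⟨(measurable_mlDensity hν0 hb).aestronglyMeasurable, ?_⟩
  rw [hasFiniteIntegral_iff_ofReal]
  · exact (lintegral_mlDensity_le_one hν0 hν1 hb).trans_lt ENNReal.one_lt_top
  · filter_upwards [ae_restrict_mem measurableSet_Ioi] with t ht
    exact mlDensity_nonneg hν0 hν1 hb ht

lemma integral_mlDensity_le_one {ν b : ℝ} (hν0 : 0 < ν) (hν1 : ν ≤ 1) (hb : 0 < b) :
    ∫ t in Ioi (0 : ℝ), mlDensity ν b t ≤ 1 := by
  rw [integral_eq_lintegral_of_nonneg_ae]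
  · exact ENNReal.toReal_le_of_le_ofReal zero_le_one
      (by simpa using lintegral_mlDensity_le_one hν0 hν1 hb)
  · filter_upwards [ae_restrict_mem measurableSet_Ioi] with t ht
    exact mlDensity_nonneg hν0 hν1 hb ht
  · exact (measurable_mlDensity hν0 hb).aestronglyMeasurable

/-- The Laplace transform of the primitive of an integrable function `g`. -/
lemma laplace_primitive {g : ℝ → ℝ} {s : ℝ} (hs : 0 < s) (hg : Integrable g)
    (hcont : ∀ x, 0 < x → ContinuousAt g x) :
    IntegrableOn (fun t => Real.exp (-(s * t)) * ∫ u in (0 : ℝ)..t, g u) (Ioi 0) ∧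
      ∫ t in Ioi (0 : ℝ), Real.exp (-(s * t)) * ∫ u in (0 : ℝ)..t, g u =
        s⁻¹ * ∫ t in Ioi (0 : ℝ), Real.exp (-(s * t)) * g t := by
  have hexp0 : IntegrableOn (fun t => Real.exp (-(s * t))) (Ioi 0) := by
    simpa using integrableOn_exp_mul_pow hs 0
  have hHcont : Continuous fun t => ∫ u in (0 : ℝ)..t, g u :=
    intervalIntegral.continuous_primitive (fun a b => hg.intervalIntegrable) 0
  have hHb (t : ℝ) : ‖∫ u in (0 : ℝ)..t, g u‖ ≤ ∫ u, ‖g u‖ :=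
    (intervalIntegral.norm_integral_le_integral_norm_uIoc).trans
      (setIntegral_le_integral hg.norm (ae_of_all _ fun _ => norm_nonneg _))
  have hI1 : IntegrableOn (fun t => Real.exp (-(s * t)) * ∫ u in (0 : ℝ)..t, g u) (Ioi 0) := by
    refine (hexp0.mul_const (∫ u, ‖g u‖)).mono' (by fun_prop) (ae_of_all _ fun t => ?_)
    rw [norm_mul, Real.norm_of_nonneg (Real.exp_pos _).le]
    gcongr
    exact hHb t
  refine ⟨hI1, ?_⟩
  have hI2 : IntegrableOn (fun t => Real.exp (-(s * t)) * g t) (Ioi 0) := by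
    refine hg.norm.integrableOn.mono' ((by fun_prop : Continuous fun t : ℝ =>
      Real.exp (-(s * t))).aestronglyMeasurable.mul hg.1.restrict) ?_
    filter_upwards [ae_restrict_mem measurableSet_Ioi] with t ht
    have ht : 0 < t := ht
    rw [norm_mul, Real.norm_of_nonneg (Real.exp_pos _).le]
    refine mul_le_of_le_one_left (norm_nonneg _) (Real.exp_le_one_iff.2 ?_)
    nlinarith
  have hatTop : Tendsto (fun t => Real.exp (-(s * t))) atTop (𝓝 0) :=
    Real.tendsto_exp_neg_atTop_nhds_zero.comp (tendsto_id.const_mul_atTop hs)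
  have hH0 : Tendsto (fun t => ∫ u in (0 : ℝ)..t, g u) (𝓝[>] 0) (𝓝 0) := by
    have := hHcont.tendsto 0
    rw [intervalIntegral.integral_same] at this
    exact this.mono_left nhdsWithin_le_nhds
  have key := integral_Ioi_mul_deriv_eq_deriv_mul (a := 0) (a' := 0) (b' := 0)
    (u := fun t => ∫ u in (0 : ℝ)..t, g u) (u' := g)
    (v := fun t => -(s⁻¹ * Real.exp (-(s * t)))) (v' := fun t => Real.exp (-(s * t)))
    (fun x hx => intervalIntegral.integral_hasDerivAt_right hg.intervalIntegrable
      hg.1.stronglyMeasurableAtFilter (hcont x hx)) (fun x _ => ?_) ?_ ?_ ?_ ?_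
  · simp only [sub_zero, zero_sub, mul_neg, integral_neg, neg_neg] at key
    rw [← integral_const_mul, setIntegral_congr_fun measurableSet_Ioi
      (g := fun t => (∫ u in (0 : ℝ)..t, g u) * Real.exp (-(s * t))) (fun t _ => mul_comm _ _), key]
    exact integral_congr_ae (ae_of_all _ fun t => by simp only; ring)
  · have h1 : HasDerivAt (fun t : ℝ => -(s * t)) (-s) x :=
      (((hasDerivAt_id x).const_mul s).congr_deriv (mul_one s)).neg
    refine (h1.exp.const_mul s⁻¹).neg.congr_deriv ?_
    field_simp
  · refine hI1.congr_fun (fun t _ => ?_) measurableSet_Ioi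
    simp only [Pi.mul_apply]; ring
  · refine (hI2.const_mul (-s⁻¹)).congr (ae_of_all _ fun t => ?_)
    simp only [Pi.mul_apply]; ring
  · have h1 : Tendsto (fun t : ℝ => -(s⁻¹ * Real.exp (-(s * t)))) (𝓝[>] 0)
        (𝓝 (-(s⁻¹ * Real.exp (-(s * 0))))) :=
      (Continuous.tendsto (by fun_prop) 0).mono_left nhdsWithin_le_nhds
    exact (hH0.mul h1).trans_eq (by rw [zero_mul])
  · have h1 : Tendsto (fun t : ℝ => -(s⁻¹ * Real.exp (-(s * t)))) atTop (𝓝 0) := by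
      simpa using (hatTop.const_mul s⁻¹).neg
    exact h1.zero_mul_isBoundedUnder_le
      (isBoundedUnder_of ⟨∫ u, ‖g u‖, hHb⟩) |>.congr fun t => mul_comm _ _

/-- The function `νb ∫₀ˣ h - x h(x)`, for `h = mlDensity ν b`, has the completely monotone Laplace
transform `νb s⁻¹ (1 + s ^ ν) ^ (-b - 1)`, so it is nonnegative. -/
lemma mul_mlDensity_le {ν b x : ℝ} (hν0 : 0 < ν) (hν1 : ν ≤ 1) (hb : 0 < b) (hx : 0 < x) :
    x * mlDensity ν b x ≤ ν * b := by
  have hm := measurable_mlDensity hν0 hb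
  have hint (s : ℝ) (hs : 1 < s) := (laplace_mlDensity hν0 hb hs).1
  have hL (s : ℝ) (hs : 1 < s) := (laplace_mlDensity hν0 hb hs).2
  set g : ℝ → ℝ := (Ioi (0 : ℝ)).indicator (mlDensity ν b) with hg
  have hgint : Integrable g := (integrableOn_mlDensity hν0 hν1 hb).integrable_indicator
    measurableSet_Ioi
  have hg0 (t : ℝ) : 0 ≤ g t := indicator_nonneg (fun t ht => mlDensity_nonneg hν0 hν1 hb ht) t
  have hgcont (t : ℝ) (ht : 0 < t) : ContinuousAt g t := by
    refine (continuousAt_mlDensity hν0 hb ht).congr ?_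
    filter_upwards [Ioi_mem_nhds ht] with u hu
    exact (indicator_of_mem hu _).symm
  set H : ℝ → ℝ := fun t => ∫ u in (0 : ℝ)..t, g u with hH
  have hHcont : Continuous H :=
    intervalIntegral.continuous_primitive (fun a b => hgint.intervalIntegrable) 0
  have hH0 (t : ℝ) (ht : 0 ≤ t) : 0 ≤ H t := intervalIntegral.integral_nonneg ht fun u _ => hg0 u
  have hH1 (t : ℝ) (ht : 0 ≤ t) : H t ≤ 1 := by
    rw [hH]
    simp only
    rw [intervalIntegral.integral_of_le ht]
    refine (setIntegral_le_integral hgint (ae_of_all _ hg0)).trans ?_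
    rw [hg, integral_indicator measurableSet_Ioi]
    exact integral_mlDensity_le_one hν0 hν1 hb
  have hHL (s : ℝ) (hs : 1 < s) := laplace_primitive (by linarith : 0 < s) hgint hgcont
  have htint (s : ℝ) (hs : 1 < s) := (hasDerivAt_laplace hm hint hs).1
  have hder (s : ℝ) (hs : 0 < s) : HasDerivAt (fun s : ℝ => (1 + s ^ ν) ^ (-b))
      (-(ν * b * s ^ (ν - 1) * (1 + s ^ ν) ^ (-b - 1))) s := by
    have h2 : HasDerivAt (fun s : ℝ => 1 + s ^ ν) (ν * s ^ (ν - 1)) s :=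
      (Real.hasDerivAt_rpow_const (Or.inl hs.ne')).const_add 1
    refine (h2.rpow_const (p := -b) (Or.inl (by positivity))).congr_deriv ?_
    ring
  have htL (s : ℝ) (hs : 1 < s) := neg_deriv_eq_laplace zero_le_one hm hint hL hder hs
  obtain ⟨M, hM⟩ := exists_abs_mlDensity_le hν0 hb
  have hνb : 0 < ν * b := by positivity
  have key := nonneg_of_laplace_cm (f := fun t => ν * b * H t - t * mlDensity ν b t) (K := 3)
    (F := fun s => ν * b * (s ^ (-1 : ℝ) * (1 + s ^ ν) ^ (-(b + 1)))) (M := ν * b + M)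
    (by norm_num) hx (by fun_prop) ?_ ?_ ?_ ?_ (fun n => ?_)
  · simp only [sub_nonneg] at key
    exact key.trans (mul_le_of_le_one_right hνb.le (hH1 x hx.le))
  · have := continuousAt_mlDensity hν0 hb hx
    fun_prop
  · intro t ht
    have h1 : |ν * b * H t| ≤ ν * b := by
      rw [abs_of_nonneg (mul_nonneg hνb.le (hH0 t ht.le))]
      exact mul_le_of_le_one_right hνb.le (hH1 t ht.le)
    have h2 : t ≤ Real.exp t := by linarith [Real.add_one_le_exp t]
    have h3 : 1 ≤ t⁻¹ * Real.exp (3 * t) := by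
      rw [inv_mul_eq_div, one_le_div ht]
      exact h2.trans (Real.exp_le_exp.2 (by linarith))
    have h4 : |t * mlDensity ν b t| ≤ M * t⁻¹ * Real.exp (3 * t) := by
      rw [abs_mul, abs_of_pos ht]
      calc t * |mlDensity ν b t| ≤ Real.exp t * (M * t⁻¹ * Real.exp (2 * t)) := by
            gcongr; exact hM t ht
        _ = M * t⁻¹ * (Real.exp t * Real.exp (2 * t)) := by ring
        _ = _ := by rw [← Real.exp_add]; ring_nf
    calc |ν * b * H t - t * mlDensity ν b t| ≤ |ν * b * H t| + |t * mlDensity ν b t| := abs_sub _ _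
      _ ≤ ν * b * (t⁻¹ * Real.exp (3 * t)) + M * t⁻¹ * Real.exp (3 * t) :=
        add_le_add (h1.trans (le_mul_of_one_le_right hνb.le h3)) h4
      _ = _ := by ring
  · intro s hs
    refine (((hHL s hs).1.const_mul (ν * b)).sub (htint s hs)).congr (ae_of_all _ fun t => ?_)
    simp only [Pi.sub_apply, hH]
    ring
  · intro s hs
    have hs0 : 0 < s := by linarith
    have h1 : ∫ t in Ioi (0 : ℝ), Real.exp (-(s * t)) * (ν * b * H t - t * mlDensity ν b t) =
        ∫ t in Ioi (0 : ℝ), (ν * b * (Real.exp (-(s * t)) * H t) -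
          Real.exp (-(s * t)) * (t * mlDensity ν b t)) :=
      integral_congr_ae (ae_of_all _ fun t => by simp only; ring)
    have h2 : ∫ t in Ioi (0 : ℝ), Real.exp (-(s * t)) * g t = (1 + s ^ ν) ^ (-b) := by
      rw [← hL s hs]
      refine setIntegral_congr_fun measurableSet_Ioi fun t ht => ?_
      simp only [hg, indicator_of_mem ht]
    have hpos : 0 < 1 + s ^ ν := by positivity
    rw [h1, integral_sub ((hHL s hs).1.const_mul (ν * b)) (htint s hs), integral_const_mul,
      (hHL s hs).2, h2, htL s hs, show -(b + 1) = -b - 1 by ring, Real.rpow_sub_one hpos.ne',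
      Real.rpow_sub_one hs0.ne', Real.rpow_neg_one]
    field_simp
    ring
  · exact (cmUpTo_rpow_mul_one_add_rpow hν0 hν1 n zero_le_one (by positivity)).const_mul
      hνb.le

/-! ### Uniqueness of Laplace transforms -/

/-- A finite measure on `[0, ∞)` is determined by its Laplace transform on `(1, ∞)`: the complex
Laplace transform is analytic on the open half-plane, and its boundary values are the
characteristic function. -/
lemma ext_of_laplace {μ μ' : Measure ℝ} [IsFiniteMeasure μ] [IsFiniteMeasure μ']
    (hμ : ∀ᵐ x ∂μ, 0 ≤ x) (hμ' : ∀ᵐ x ∂μ', 0 ≤ x)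
    (h : ∀ s, 1 < s → ∫ x, Real.exp (-(s * x)) ∂μ = ∫ x, Real.exp (-(s * x)) ∂μ') : μ = μ' := by
  have hset (μ : Measure ℝ) [IsFiniteMeasure μ] (hμ : ∀ᵐ x ∂μ, 0 ≤ x) :
      Iio 0 ⊆ interior (ProbabilityTheory.integrableExpSet id μ) := by
    refine isOpen_Iio.subset_interior_iff.2 fun t ht => ?_
    refine (integrable_const (1 : ℝ)).mono' (by fun_prop) ?_
    filter_upwards [hμ] with x hx
    rw [Real.norm_of_nonneg (Real.exp_pos _).le]
    exact Real.exp_le_one_iff.2 (mul_nonpos_of_nonpos_of_nonneg (le_of_lt ht) hx)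
  have han (μ : Measure ℝ) [IsFiniteMeasure μ] (hμ : ∀ᵐ x ∂μ, 0 ≤ x) :
      AnalyticOnNhd ℂ (ProbabilityTheory.complexMGF id μ) {z | z.re < 0} :=
    ProbabilityTheory.analyticOnNhd_complexMGF.mono fun z hz => hset μ hμ hz
  have hEq : EqOn (ProbabilityTheory.complexMGF id μ) (ProbabilityTheory.complexMGF id μ')
      {z | z.re < 0} := by
    refine (han μ hμ).eqOn_of_preconnected_of_frequently_eq (han μ' hμ')
      (convex_halfSpace_re_lt 0).isPreconnected (z₀ := ((-2 : ℝ) : ℂ)) (by simp) ?_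
    have h1 : ∃ᶠ t : ℝ in 𝓝[≠] (-2 : ℝ), ProbabilityTheory.complexMGF id μ (t : ℂ) =
        ProbabilityTheory.complexMGF id μ' (t : ℂ) := by
      refine Eventually.frequently ?_
      have : ∀ᶠ t : ℝ in 𝓝[≠] (-2 : ℝ), t < -1 :=
        eventually_nhdsWithin_of_eventually_nhds (Iio_mem_nhds (by norm_num))
      filter_upwards [this] with t ht
      rw [ProbabilityTheory.complexMGF_ofReal, ProbabilityTheory.complexMGF_ofReal]
      have := h (-t) (by linarith)
      simpa [ProbabilityTheory.mgf] using this
    have h2 : Tendsto (fun t : ℝ => (t : ℂ)) (𝓝[≠] (-2 : ℝ)) (𝓝[≠] ((-2 : ℝ) : ℂ)) :=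
      tendsto_nhdsWithin_of_tendsto_nhds_of_eventually_within _
        (Complex.continuous_ofReal.continuousAt.mono_left nhdsWithin_le_nhds)
        (eventually_nhdsWithin_of_forall fun t ht => by simpa using Complex.ofReal_injective.ne ht)
    exact h2.frequently h1
  have hlim (μ : Measure ℝ) [IsFiniteMeasure μ] (hμ : ∀ᵐ x ∂μ, 0 ≤ x) (t : ℝ) :
      Tendsto (fun ε : ℝ => ProbabilityTheory.complexMGF id μ (ε + t * Complex.I)) (𝓝[<] 0)
        (𝓝 (charFun μ t)) := by
    rw [charFun_apply_real]
    refine tendsto_integral_filter_of_dominated_convergence (fun _ => 1)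
      (Eventually.of_forall fun ε => by fun_prop) ?_ (integrable_const _) (ae_of_all _ fun x => ?_)
    · filter_upwards [self_mem_nhdsWithin] with ε hε
      filter_upwards [hμ] with x hx
      rw [Complex.norm_exp]
      refine Real.exp_le_one_iff.2 ?_
      simpa using mul_nonpos_of_nonpos_of_nonneg (le_of_lt hε) hx
    · have : Continuous fun ε : ℝ => Complex.exp ((ε + t * Complex.I) * (id x : ℝ)) := by fun_prop
      refine ((this.tendsto 0).mono_left nhdsWithin_le_nhds).trans_eq ?_
      simp only [id]
      congr 2
      push_cast
      ring
  refine Measure.ext_of_charFun (funext fun t => ?_)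
  refine tendsto_nhds_unique ((hlim μ hμ t).congr' ?_) (hlim μ' hμ' t)
  filter_upwards [self_mem_nhdsWithin] with ε hε
  exact hEq (by simpa using hε)

end FracDirichlet

/-! ### Product measures with densities -/

lemma lintegral_pi_fin_prod {n : ℕ} (μ : Fin n → Measure ℝ) [∀ i, SigmaFinite (μ i)]
    {f : Fin n → ℝ → ℝ≥0∞} (hf : ∀ i, Measurable (f i)) :
    ∫⁻ x, ∏ i, f i (x i) ∂Measure.pi μ = ∏ i, ∫⁻ x, f i x ∂μ i := by
  induction n with
  | zero => simp
  | succ n ih =>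
    rw [← ((measurePreserving_piFinSuccAbove μ 0).symm).lintegral_comp_emb
      (MeasurableEquiv.measurableEmbedding _)]
    simp only [MeasurableEquiv.piFinSuccAbove_symm_apply, Fin.insertNthEquiv, Fin.prod_univ_succ,
      Fin.insertNth_zero, Equiv.coe_fn_mk, Fin.cons_succ, Fin.zero_succAbove, cast_eq,
      Fin.cons_zero]
    have hprod : Measurable fun x : Fin n → ℝ => ∏ i, f i.succ (x i) :=
      Finset.measurable_fun_prod _ fun i _ => (hf i.succ).comp (measurable_pi_apply i)
    rw [lintegral_prod_mul (hf 0).aemeasurable hprod.aemeasurable, ih _ fun i => hf i.succ]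

lemma pi_withDensity {n : ℕ} (μ : Fin n → Measure ℝ) [∀ i, SigmaFinite (μ i)]
    {f : Fin n → ℝ → ℝ≥0∞} (hf : ∀ i, Measurable (f i))
    [∀ i, SigmaFinite ((μ i).withDensity (f i))] :
    Measure.pi (fun i => (μ i).withDensity (f i)) =
      (Measure.pi μ).withDensity fun x => ∏ i, f i (x i) := by
  refine Measure.pi_eq fun s hs => ?_
  rw [withDensity_apply _ (MeasurableSet.univ_pi hs), ← lintegral_indicator
    (MeasurableSet.univ_pi hs)]
  have h1 (x : Fin n → ℝ) : (univ.pi s).indicator (fun x => ∏ i, f i (x i)) x =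
      ∏ i, (s i).indicator (f i) (x i) := by
    by_cases hx : x ∈ univ.pi s
    · rw [indicator_of_mem hx]
      exact Finset.prod_congr rfl fun i _ => (indicator_of_mem (hx i (mem_univ i)) _).symm
    · rw [indicator_of_notMem hx]
      obtain ⟨i, hi⟩ : ∃ i, x i ∉ s i := by simpa using hx
      exact (Finset.prod_eq_zero (Finset.mem_univ i) (indicator_of_notMem hi _)).symm
  simp only [h1]
  rw [lintegral_pi_fin_prod μ fun i => (hf i).indicator (hs i)]
  refine Finset.prod_congr rfl fun i _ => ?_
  rw [withDensity_apply _ (hs i), lintegral_indicator (hs i)]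

/-! ### Normalization by the sum -/

/-- Change of variables to the total `y = ℓ x + z` and the proportions `q = x / y`, with Jacobian
`y ^ dim E`. -/
lemma lintegral_lintegral_eq_total_proportion {E : Type*} [NormedAddCommGroup E] [NormedSpace ℝ E]
    [FiniteDimensional ℝ E] [MeasureSpace E] [BorelSpace E]
    [(volume : Measure E).IsAddHaarMeasure] [SFinite (volume : Measure E)]
    (ℓ : E →ₗ[ℝ] ℝ) {G : E → ℝ → ℝ≥0∞}
    (hG : Measurable (Function.uncurry G)) (hG0 : ∀ x z, ℓ x + z ≤ 0 → G x z = 0) :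
    ∫⁻ x, ∫⁻ z, G x z = ∫⁻ q, ∫⁻ y in Ioi (0 : ℝ),
      ENNReal.ofReal (y ^ Module.finrank ℝ E) * G (y • q) (y - y * ℓ q) := by
  have hℓ : Measurable ℓ := (LinearMap.continuous_of_finiteDimensional ℓ).measurable
  have hG1 (y : ℝ) : Measurable fun x => G x (y - ℓ x) :=
    hG.comp (by fun_prop : Measurable fun x : E => (x, y - ℓ x))
  have hG2 (y : ℝ) : Measurable fun q => G (y • q) (y - y * ℓ q) :=
    hG.comp (by fun_prop : Measurable fun q : E => (y • q, y - y * ℓ q))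
  have hG3 : Measurable fun p : E × ℝ => G p.1 (p.2 - ℓ p.1) :=
    hG.comp (by fun_prop : Measurable fun p : E × ℝ => (p.1, p.2 - ℓ p.1))
  have hG4 : Measurable fun p : ℝ × E => G (p.1 • p.2) (p.1 - p.1 * ℓ p.2) :=
    hG.comp (by fun_prop : Measurable fun p : ℝ × E => (p.1 • p.2, p.1 - p.1 * ℓ p.2))
  have hshift (x : E) : ∫⁻ z, G x z = ∫⁻ y in Ioi (0 : ℝ), G x (y - ℓ x) := by
    rw [← lintegral_sub_right_eq_self (fun z => G x z) (ℓ x)]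
    refine (setLIntegral_eq_of_support_subset fun y hy => ?_).symm
    by_contra h
    exact hy (hG0 _ _ (by simpa using h))
  have hscale (y : ℝ) (hy : 0 < y) : ∫⁻ x, G x (y - ℓ x) =
      ∫⁻ q, ENNReal.ofReal (y ^ Module.finrank ℝ E) * G (y • q) (y - y * ℓ q) := by
    have h1 := Measure.map_addHaar_smul (volume : Measure E) hy.ne'
    have h2 : ∫⁻ q, G (y • q) (y - ℓ (y • q)) =
        ENNReal.ofReal (y ^ Module.finrank ℝ E)⁻¹ * ∫⁻ x, G x (y - ℓ x) := by
      rw [← lintegral_map (f := fun x => G x (y - ℓ x)) (g := fun q : E => y • q)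
        (hG1 y) (by fun_prop), h1, lintegral_smul_measure,
        abs_of_pos (by positivity), smul_eq_mul]
    simp only [map_smul, smul_eq_mul] at h2
    rw [lintegral_const_mul _ (hG2 y), h2, ← mul_assoc,
      ← ENNReal.ofReal_mul (by positivity), mul_inv_cancel₀ (by positivity), ENNReal.ofReal_one,
      one_mul]
  simp only [hshift]
  rw [lintegral_lintegral_swap hG3.aemeasurable,
    setLIntegral_congr_fun measurableSet_Ioi hscale, lintegral_lintegral_swap]
  exact ((by fun_prop : Measurable fun p : ℝ × E =>
    ENNReal.ofReal (p.1 ^ Module.finrank ℝ E)).mul hG4).aemeasurable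

namespace FracDirichlet

/-! ### Mittag-Leffler distributions -/

/-- The density `mlDensity` on `(0, ∞)`, extended by zero. -/
noncomputable def mlPdf (ν b : ℝ) : ℝ → ℝ≥0∞ :=
  (Ioi (0 : ℝ)).indicator fun x => ENNReal.ofReal (mlDensity ν b x)

lemma mlPdf_of_pos {ν b x : ℝ} (hx : 0 < x) :
    mlPdf ν b x = ENNReal.ofReal (mlDensity ν b x) :=
  indicator_of_mem (mem_Ioi.2 hx) _

lemma mlPdf_of_nonpos {ν b x : ℝ} (hx : x ≤ 0) : mlPdf ν b x = 0 :=
  indicator_of_notMem (fun h => hx.not_gt h) _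

lemma measurable_mlPdf {ν b : ℝ} (hν : 0 < ν) (hb : 0 < b) : Measurable (mlPdf ν b) :=
  (measurable_mlDensity hν hb).ennreal_ofReal.indicator measurableSet_Ioi

/-- The (generalized) Mittag-Leffler distribution, whose Laplace transform is
`s ↦ (1 + s ^ ν) ^ (-b)`. -/
noncomputable def mlMeasure (ν b : ℝ) : Measure ℝ := volume.withDensity (mlPdf ν b)

lemma isFiniteMeasure_mlMeasure {ν b : ℝ} (hν0 : 0 < ν) (hν1 : ν ≤ 1) (hb : 0 < b) :
    IsFiniteMeasure (mlMeasure ν b) := by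
  refine isFiniteMeasure_withDensity (ne_of_lt ?_)
  rw [mlPdf, lintegral_indicator measurableSet_Ioi]
  exact (lintegral_mlDensity_le_one hν0 hν1 hb).trans_lt ENNReal.one_lt_top

lemma ae_nonneg_mlMeasure {ν b : ℝ} (hν : 0 < ν) (hb : 0 < b) : ∀ᵐ x ∂mlMeasure ν b, 0 ≤ x := by
  rw [mlMeasure, ae_withDensity_iff (measurable_mlPdf hν hb)]
  refine ae_of_all _ fun x hx => ?_
  by_contra! h
  exact hx (mlPdf_of_nonpos h.le)

lemma laplace_mlMeasure {ν b s : ℝ} (hν0 : 0 < ν) (hν1 : ν ≤ 1) (hb : 0 < b) (hs : 1 < s) :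
    ∫ x, Real.exp (-(s * x)) ∂mlMeasure ν b = (1 + s ^ ν) ^ (-b) := by
  rw [mlMeasure, integral_withDensity_eq_integral_toReal_smul (measurable_mlPdf hν0 hb)
    (ae_of_all _ fun x => ?_), ← (laplace_mlDensity hν0 hb hs).2,
    ← integral_indicator measurableSet_Ioi]
  · refine integral_congr_ae (ae_of_all _ fun x => ?_)
    by_cases hx : 0 < x
    · simp only [mlPdf_of_pos hx, indicator_of_mem (mem_Ioi.2 hx), smul_eq_mul,
        ENNReal.toReal_ofReal (mlDensity_nonneg hν0 hν1 hb hx)]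
      ring
    · simp only [mlPdf_of_nonpos (not_lt.1 hx), indicator_of_notMem (s := Ioi (0 : ℝ)) hx,
        ENNReal.toReal_zero, zero_smul]
  · by_cases hx : 0 < x
    · simp [mlPdf_of_pos hx]
    · simp [mlPdf_of_nonpos (not_lt.1 hx)]

/-- Mittag-Leffler distributions with the same `ν` form a convolution family in `b`. -/
lemma map_sum_pi_mlMeasure {ν : ℝ} (hν0 : 0 < ν) (hν1 : ν ≤ 1) {m : ℕ} (hm : 1 ≤ m)
    {b : Fin m → ℝ} (hb : ∀ j, 0 < b j) :
    (Measure.pi fun j => mlMeasure ν (b j)).map (fun x => ∑ j, x j) = mlMeasure ν (∑ j, b j) := by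
  have : NeZero m := ⟨by omega⟩
  have hsum : 0 < ∑ j, b j := Finset.sum_pos (fun j _ => hb j) Finset.univ_nonempty
  have (j : Fin m) := isFiniteMeasure_mlMeasure hν0 hν1 (hb j)
  have := isFiniteMeasure_mlMeasure hν0 hν1 hsum
  have hmeas : Measurable fun x : Fin m → ℝ => ∑ j, x j := by fun_prop
  refine ext_of_laplace ?_ (ae_nonneg_mlMeasure hν0 hsum) fun s hs => ?_
  · rw [ae_map_iff hmeas.aemeasurable measurableSet_Ici]
    have h1 : ∀ᵐ x ∂(Measure.pi fun j => mlMeasure ν (b j)), ∀ j, 0 ≤ x j :=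
      ae_all_iff.2 fun j => Measure.tendsto_eval_ae_ae.eventually (ae_nonneg_mlMeasure hν0 (hb j))
    filter_upwards [h1] with x hx
    exact Finset.sum_nonneg fun j _ => hx j
  · rw [integral_map hmeas.aemeasurable (by fun_prop), laplace_mlMeasure hν0 hν1 hsum hs]
    have h1 (x : Fin m → ℝ) : Real.exp (-(s * ∑ j, x j)) = ∏ j, Real.exp (-(s * x j)) := by
      rw [← Real.exp_sum, Finset.mul_sum, Finset.sum_neg_distrib]
    simp only [h1]
    rw [integral_fintype_prod_eq_prod (fun _ x => Real.exp (-(s * x)))]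
    simp only [laplace_mlMeasure hν0 hν1 (hb _) hs]
    rw [← Finset.sum_neg_distrib, Real.rpow_sum_of_pos (by positivity)]

/-! ### The marginal density -/

lemma mlDensity_mul {ν b y q : ℝ} (hy : 0 < y) (hq : 0 < q) :
    mlDensity ν b (y * q) = y ^ (ν * b - 1) * q ^ (ν * b - 1) *
      mittagLeffler ν (ν * b) b (-((y * q) ^ ν)) := by
  rw [mlDensity, Real.mul_rpow hy.le hq.le]

lemma rpow_mul_marginalIntegrand {ν b s q y : ℝ} (hq : q ∈ Ioo (0 : ℝ) 1) (hy : 0 < y) :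
    q ^ (ν * b - 1) * (1 - q) ^ (ν * (s - b) - 1) * marginalIntegrand ν b s q y =
      y * (mlDensity ν b (y * q) * mlDensity ν (s - b) (y * (1 - q))) := by
  have hy1 : y ^ (ν * s - 1) = y * y ^ (ν * b - 1) * y ^ (ν * (s - b) - 1) := by
    rw [show ν * s - 1 = 1 + (ν * b - 1) + (ν * (s - b) - 1) by ring, Real.rpow_add hy,
      Real.rpow_add hy, Real.rpow_one]
  rw [mlDensity_mul hy hq.1, mlDensity_mul hy (sub_pos.2 hq.2), marginalIntegrand, hy1]
  ring

lemma integrableOn_marginalIntegrand {ν b s q : ℝ} (hν0 : 0 < ν) (hν1 : ν ≤ 1) (hb : 0 < b)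
    (hbs : b < s) (hq : q ∈ Ioo (0 : ℝ) 1) :
    IntegrableOn (marginalIntegrand ν b s q) (Ioi 0) := by
  have hc : 0 < s - b := sub_pos.2 hbs
  have hq1 : 0 < 1 - q := sub_pos.2 hq.2
  have hE1 := continuous_mittagLeffler hν0 hb
  have hE2 := continuous_mittagLeffler hν0 hc
  have hcont1 : Continuous fun y : ℝ => mittagLeffler ν (ν * b) b (-((y * q) ^ ν)) :=
    hE1.comp ((continuous_id.mul continuous_const).rpow_const fun _ => Or.inr hν0.le).neg
  have hcont2 : Continuous fun y : ℝ =>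
      mittagLeffler ν (ν * (s - b)) (s - b) (-((y * (1 - q)) ^ ν)) :=
    hE2.comp ((continuous_id.mul continuous_const).rpow_const fun _ => Or.inr hν0.le).neg
  rw [← Ioc_union_Ioi_eq_Ioi (zero_le_one (α := ℝ))]
  refine IntegrableOn.union ?_ ?_
  -- Near `0` the Mittag-Leffler factors are bounded and `y ^ (νs - 1)` is integrable; at infinity
  -- `y h_b(yq)` is bounded and `h_{s - b}` is integrable.
  · have h1 : IntegrableOn (fun y : ℝ => y ^ (ν * s - 1)) (Icc 0 1) := by
      have hνs : 0 < ν * s := mul_pos hν0 (hb.trans hbs)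
      rw [integrableOn_Icc_iff_integrableOn_Ioc,
        ← intervalIntegrable_iff_integrableOn_Ioc_of_le zero_le_one]
      exact intervalIntegral.intervalIntegrable_rpow' (by linarith)
    exact ((h1.mul_continuousOn hcont1.continuousOn isCompact_Icc).mul_continuousOn
      hcont2.continuousOn isCompact_Icc).mono_set Ioc_subset_Icc_self
  · set C : ℝ := q ^ (ν * b - 1) * (1 - q) ^ (ν * (s - b) - 1) with hC
    have hC0 : 0 < C := mul_pos (Real.rpow_pos_of_pos hq.1 _) (Real.rpow_pos_of_pos hq1 _)
    have hdom : IntegrableOn (fun y => mlDensity ν (s - b) (y * (1 - q))) (Ioi 1) := by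
      rw [integrableOn_Ioi_comp_mul_right_iff _ _ hq1]
      exact (integrableOn_mlDensity hν0 hν1 hc).mono_set fun y hy =>
        (mul_pos one_pos hq1).trans hy
    refine (hdom.const_mul (C⁻¹ * (ν * b / q))).mono' ?_ ?_
    · exact (((by fun_prop : Measurable fun y : ℝ => y ^ (ν * s - 1)).mul
        hcont1.measurable).mul hcont2.measurable).aestronglyMeasurable
    · filter_upwards [ae_restrict_mem measurableSet_Ioi] with y hy
      have hy0 : 0 < y := one_pos.trans hy
      have hh := mlDensity_nonneg hν0 hν1 hb (mul_pos hy0 hq.1)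
      have hh' := mlDensity_nonneg hν0 hν1 hc (mul_pos hy0 hq1)
      have h1 : marginalIntegrand ν b s q y =
          C⁻¹ * (y * (mlDensity ν b (y * q) * mlDensity ν (s - b) (y * (1 - q)))) := by
        rw [← rpow_mul_marginalIntegrand hq hy0, ← hC]
        field_simp
      have h2 : y * mlDensity ν b (y * q) ≤ ν * b / q := by
        rw [le_div_iff₀ hq.1]
        calc y * mlDensity ν b (y * q) * q = y * q * mlDensity ν b (y * q) := by ring
          _ ≤ ν * b := mul_mlDensity_le hν0 hν1 hb (mul_pos hy0 hq.1)
      rw [h1, Real.norm_of_nonneg (by positivity), mul_assoc, ← mul_assoc y]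
      gcongr

lemma marginalDensity_eq_integral {ν b s q : ℝ} (hq : q ∈ Ioo (0 : ℝ) 1) :
    marginalDensity ν b s q =
      ∫ y in Ioi (0 : ℝ), y * (mlDensity ν b (y * q) * mlDensity ν (s - b) (y * (1 - q))) := by
  rw [marginalDensity, ← integral_const_mul]
  exact setIntegral_congr_fun measurableSet_Ioi fun y hy => rpow_mul_marginalIntegrand hq hy

lemma marginalDensity_nonneg {ν b s q : ℝ} (hν0 : 0 < ν) (hν1 : ν ≤ 1) (hb : 0 < b)
    (hbs : b < s) (hq : q ∈ Ioo (0 : ℝ) 1) : 0 ≤ marginalDensity ν b s q := by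
  rw [marginalDensity_eq_integral hq]
  refine setIntegral_nonneg measurableSet_Ioi fun y hy =>
    mul_nonneg (le_of_lt hy) (mul_nonneg ?_ ?_)
  · exact mlDensity_nonneg hν0 hν1 hb (mul_pos hy hq.1)
  · exact mlDensity_nonneg hν0 hν1 (sub_pos.2 hbs) (mul_pos hy (sub_pos.2 hq.2))

lemma ofReal_marginalDensity {ν b s q : ℝ} (hν0 : 0 < ν) (hν1 : ν ≤ 1) (hb : 0 < b)
    (hbs : b < s) (hq : q ∈ Ioo (0 : ℝ) 1) :
    ENNReal.ofReal (marginalDensity ν b s q) =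
      ∫⁻ y in Ioi (0 : ℝ),
        ENNReal.ofReal y * (mlPdf ν b (y * q) * mlPdf ν (s - b) (y - y * q)) := by
  have hq1 : 0 < 1 - q := sub_pos.2 hq.2
  have hnn (y : ℝ) (hy : 0 < y) : 0 ≤ mlDensity ν b (y * q) :=
    mlDensity_nonneg hν0 hν1 hb (mul_pos hy hq.1)
  have hnn' (y : ℝ) (hy : 0 < y) : 0 ≤ mlDensity ν (s - b) (y * (1 - q)) :=
    mlDensity_nonneg hν0 hν1 (sub_pos.2 hbs) (mul_pos hy hq1)
  rw [marginalDensity_eq_integral hq, ofReal_integral_eq_lintegral_ofReal]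
  · refine setLIntegral_congr_fun measurableSet_Ioi fun y hy => ?_
    have hy : 0 < y := hy
    have h1 : y - y * q = y * (1 - q) := by ring
    simp only [h1]
    rw [mlPdf_of_pos (mul_pos hy hq.1), mlPdf_of_pos (mul_pos hy hq1),
      ENNReal.ofReal_mul hy.le, ENNReal.ofReal_mul (hnn y hy)]
  · exact IntegrableOn.congr_fun ((integrableOn_marginalIntegrand hν0 hν1 hb hbs hq).const_mul
      (q ^ (ν * b - 1) * (1 - q) ^ (ν * (s - b) - 1)))
      (fun y hy => rpow_mul_marginalIntegrand hq hy) measurableSet_Ioi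
  · filter_upwards [ae_restrict_mem measurableSet_Ioi] with y hy
    have hy : 0 < y := hy
    exact mul_nonneg hy.le (mul_nonneg (hnn y hy) (hnn' y hy))

lemma aemeasurable_marginalDensity {ν b s : ℝ} (hν0 : 0 < ν) (hν1 : ν ≤ 1) (hb : 0 < b)
    (hbs : b < s) : AEMeasurable (fun q => ENNReal.ofReal (marginalDensity ν b s q))
      (volume.restrict (Ioo 0 1)) := by
  have hm1 := measurable_mlPdf hν0 hb
  have hm2 := measurable_mlPdf hν0 (sub_pos.2 hbs)
  refine AEMeasurable.congr (Measurable.aemeasurable (Measurable.lintegral_prod_right'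
    (f := fun p : ℝ × ℝ => ENNReal.ofReal p.2 *
      (mlPdf ν b (p.2 * p.1) * mlPdf ν (s - b) (p.2 - p.2 * p.1)))
    (ν := volume.restrict (Ioi 0)) (by fun_prop))) ?_
  filter_upwards [ae_restrict_mem measurableSet_Ioo] with q hq
  exact (ofReal_marginalDensity hν0 hν1 hb hbs hq).symm

/-- The marginal density is the density of `U / (U + V)` for independent Mittag-Leffler variables
`U` and `V`. -/
lemma lintegral_marginalDensity {ν b s : ℝ} (hν0 : 0 < ν) (hν1 : ν ≤ 1) (hb : 0 < b)
    (hbs : b < s) {φ : ℝ → ℝ≥0∞} (hφ : Measurable φ) :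
    ∫⁻ q in Ioo (0 : ℝ) 1, ENNReal.ofReal (marginalDensity ν b s q) * φ q =
      ∫⁻ p, φ (p.1 / (p.1 + p.2)) ∂(mlMeasure ν b).prod (mlMeasure ν (s - b)) := by
  have hc : 0 < s - b := sub_pos.2 hbs
  have hm1 := measurable_mlPdf hν0 hb
  have hm2 := measurable_mlPdf hν0 hc
  set G : ℝ → ℝ → ℝ≥0∞ := fun u v => mlPdf ν b u * mlPdf ν (s - b) v * φ (u / (u + v)) with hG
  have hGm : Measurable (Function.uncurry G) := by
    simp only [hG, Function.uncurry_def]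
    fun_prop
  have hG0 (u v : ℝ) (h : LinearMap.id (R := ℝ) u + v ≤ 0) : G u v = 0 := by
    simp only [LinearMap.id_coe, id] at h
    rcases le_or_gt u 0 with hu | hu
    · simp [hG, mlPdf_of_nonpos hu]
    · simp [hG, mlPdf_of_nonpos (show v ≤ 0 by linarith)]
  have := isFiniteMeasure_mlMeasure hν0 hν1 hc
  rw [mlMeasure, mlMeasure, prod_withDensity hm1 hm2, lintegral_withDensity_eq_lintegral_mul _
    (by fun_prop) (by fun_prop), lintegral_prod _ (by fun_prop)]
  refine Eq.trans ?_ (lintegral_lintegral_eq_total_proportion LinearMap.id hGm hG0).symm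
  simp only [Module.finrank_self, pow_one, LinearMap.id_coe, id, smul_eq_mul]
  rw [← lintegral_indicator measurableSet_Ioo]
  refine lintegral_congr fun q => ?_
  by_cases hq : q ∈ Ioo (0 : ℝ) 1
  · rw [indicator_of_mem hq, ofReal_marginalDensity hν0 hν1 hb hbs hq,
      ← lintegral_mul_const _ (by fun_prop)]
    refine setLIntegral_congr_fun measurableSet_Ioi fun y hy => ?_
    have hy : y ≠ 0 := ne_of_gt hy
    have h1 : y * q / (y * q + (y - y * q)) = q := by
      rw [add_sub_cancel, mul_div_cancel_left₀ _ hy]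
    simp only [hG, h1]
    ring
  · rw [indicator_of_notMem hq, eq_comm, setLIntegral_congr_fun measurableSet_Ioi
      (g := fun _ => 0), lintegral_zero]
    intro y hy
    have hy : 0 < y := hy
    simp only [hG]
    rcases le_or_gt q 0 with h | h
    · simp [mlPdf_of_nonpos (mul_nonpos_of_nonneg_of_nonpos hy.le h)]
    · have h1 : 1 ≤ q := not_lt.1 fun h' => hq ⟨h, h'⟩
      simp [mlPdf_of_nonpos (show y - y * q ≤ 0 by nlinarith)]

end FracDirichlet

lemma measurable_finSnoc (m : ℕ) :
    Measurable fun p : (Fin m → ℝ) × ℝ => (Fin.snoc p.1 p.2 : Fin (m + 1) → ℝ) := by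
  refine measurable_pi_iff.2 fun i => ?_
  induction i using Fin.lastCases with
  | last => simpa using measurable_snd
  | cast j =>
    simp only [Fin.snoc_castSucc]
    fun_prop

lemma lintegral_eq_lintegral_finSnoc {m : ℕ} {F : (Fin (m + 1) → ℝ) → ℝ≥0∞} (hF : Measurable F) :
    ∫⁻ w, F w = ∫⁻ x : Fin m → ℝ, ∫⁻ z : ℝ, F (Fin.snoc x z) := by
  rw [← ((volume_preserving_piFinSuccAbove (fun _ => ℝ) (Fin.last m)).symm).lintegral_comp_emb
    (MeasurableEquiv.measurableEmbedding _), Measure.volume_eq_prod,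
    lintegral_prod_symm' (fun p => F ((MeasurableEquiv.piFinSuccAbove (fun _ => ℝ)
      (Fin.last m)).symm p)) (hF.comp (MeasurableEquiv.measurable _))]
  refine lintegral_congr fun x => lintegral_congr fun z => ?_
  simp [Fin.insertNthEquiv, Fin.insertNth_last']

namespace FracDirichlet

/-! ### The fractional Dirichlet distribution as a law of proportions -/

lemma coordQ_eq_snoc_div {m : ℕ} (i : Fin (m + 1)) (q : Fin m → ℝ) {y : ℝ} (hy : y ≠ 0) :
    (Fin.snoc (y • q) (y - y * ∑ j, q j) : Fin (m + 1) → ℝ) i /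
      ∑ k, (Fin.snoc (y • q) (y - y * ∑ j, q j) : Fin (m + 1) → ℝ) k = coordQ m i q := by
  have hsum : ∑ k, (Fin.snoc (y • q) (y - y * ∑ j, q j) : Fin (m + 1) → ℝ) k = y := by
    simp [Fin.sum_univ_castSucc, ← Finset.mul_sum]
  rw [hsum]
  induction i using Fin.lastCases with
  | last => simp [coordQ]; field_simp
  | cast j => simp [coordQ]; field_simp

lemma measurable_coordQ {m : ℕ} (i : Fin (m + 1)) : Measurable (coordQ m i) :=
  (measurable_pi_apply i).comp ((measurable_finSnoc m).comp
    (by fun_prop : Measurable fun q : Fin m → ℝ => (q, 1 - ∑ j, q j)))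

lemma measurableSet_openSimplex (m : ℕ) : MeasurableSet (openSimplex m) := by
  simp only [openSimplex, ofPred_and, ofPred_forall]
  refine (MeasurableSet.iInter fun i => ?_).inter ?_
  · exact measurableSet_lt measurable_const (measurable_pi_apply i)
  · exact measurableSet_lt (by fun_prop) measurable_const

/-- The product `h_1(w_1) ⋯ h_{m+1}(w_{m+1})` of Mittag-Leffler densities. -/
noncomputable def mlPdfProd {m : ℕ} (ν : ℝ) (β : Fin (m + 1) → ℝ) (w : Fin (m + 1) → ℝ) : ℝ≥0∞ :=
  ∏ j, mlPdf ν (β j) (w j)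

lemma measurable_mlPdfProd {m : ℕ} {ν : ℝ} (hν0 : 0 < ν) {β : Fin (m + 1) → ℝ}
    (hβ : ∀ j, 0 < β j) : Measurable (mlPdfProd ν β) :=
  Finset.measurable_fun_prod _ fun j _ =>
    (measurable_mlPdf hν0 (hβ j)).comp (measurable_pi_apply j)

lemma mlPdfProd_eq_zero {m : ℕ} {ν : ℝ} {β w : Fin (m + 1) → ℝ} {j : Fin (m + 1)} (hj : w j ≤ 0) :
    mlPdfProd ν β w = 0 :=
  Finset.prod_eq_zero (Finset.mem_univ j) (mlPdf_of_nonpos hj)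

lemma pi_mlMeasure_eq_withDensity {m : ℕ} {ν : ℝ} (hν0 : 0 < ν) (hν1 : ν ≤ 1)
    {β : Fin (m + 1) → ℝ} (hβ : ∀ j, 0 < β j) :
    Measure.pi (fun j => mlMeasure ν (β j)) = volume.withDensity (mlPdfProd ν β) := by
  have (j : Fin (m + 1)) : IsFiniteMeasure (volume.withDensity (mlPdf ν (β j))) :=
    isFiniteMeasure_mlMeasure hν0 hν1 (hβ j)
  exact pi_withDensity (fun _ => volume) fun j => measurable_mlPdf hν0 (hβ j)

lemma jointIntegrand_eq {m : ℕ} {ν : ℝ} (β : Fin (m + 1) → ℝ) {q : Fin m → ℝ}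
    (hq : q ∈ openSimplex m) {y : ℝ} (hy : 0 < y) :
    (∏ i : Fin m, q i ^ (ν * β i.castSucc - 1)) * (1 - ∑ i, q i) ^ (ν * β (Fin.last m) - 1) *
      (y ^ (ν * (∑ j, β j) - 1)
        * (∏ i : Fin m, mittagLeffler ν (ν * β i.castSucc) (β i.castSucc) (-((y * q i) ^ ν)))
        * mittagLeffler ν (ν * β (Fin.last m)) (β (Fin.last m)) (-((y - y * ∑ i, q i) ^ ν))) =
      y ^ m * ((∏ i : Fin m, mlDensity ν (β i.castSucc) (y * q i)) *
        mlDensity ν (β (Fin.last m)) (y - y * ∑ i, q i)) := by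
  have hq1 : 0 < 1 - ∑ i, q i := sub_pos.2 hq.2
  have hy1 : y ^ (ν * (∑ j, β j) - 1) =
      y ^ m * (∏ i : Fin m, y ^ (ν * β i.castSucc - 1)) * y ^ (ν * β (Fin.last m) - 1) := by
    rw [← Real.rpow_sum_of_pos hy, ← Real.rpow_natCast, ← Real.rpow_add hy, ← Real.rpow_add hy]
    congr 1
    rw [Fin.sum_univ_castSucc, Finset.sum_sub_distrib, ← Finset.mul_sum]
    simp
    ring
  have hprod : ∏ i : Fin m, mlDensity ν (β i.castSucc) (y * q i) =
      (∏ i : Fin m, y ^ (ν * β i.castSucc - 1)) * (∏ i : Fin m, q i ^ (ν * β i.castSucc - 1)) *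
        ∏ i : Fin m, mittagLeffler ν (ν * β i.castSucc) (β i.castSucc) (-((y * q i) ^ ν)) := by
    rw [← Finset.prod_mul_distrib, ← Finset.prod_mul_distrib]
    exact Finset.prod_congr rfl fun i _ => mlDensity_mul hy (hq.1 i)
  rw [hy1, hprod, show y - y * ∑ i, q i = y * (1 - ∑ i, q i) by ring, mlDensity_mul hy hq1]
  ring

/-- The radial integral that defines the joint density, as a function with values in `[0, ∞]`. -/
noncomputable def jointPdf (m : ℕ) (ν : ℝ) (β : Fin (m + 1) → ℝ) (q : Fin m → ℝ) : ℝ≥0∞ :=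
  ∫⁻ y in Ioi (0 : ℝ), ENNReal.ofReal (y ^ m) *
    mlPdfProd ν β (Fin.snoc (y • q) (y - y * ∑ j, q j))

lemma jointPdf_eq_zero {m : ℕ} {ν : ℝ} {β : Fin (m + 1) → ℝ} {q : Fin m → ℝ}
    (hq : q ∉ openSimplex m) : jointPdf m ν β q = 0 := by
  rw [jointPdf, setLIntegral_congr_fun measurableSet_Ioi (g := fun _ => 0), lintegral_zero]
  intro y hy
  have hy : 0 < y := hy
  have : ∃ j, (Fin.snoc (y • q) (y - y * ∑ j, q j) : Fin (m + 1) → ℝ) j ≤ 0 := by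
    by_contra! h
    refine hq ⟨fun i => ?_, ?_⟩
    · have := h i.castSucc
      simp only [Fin.snoc_castSucc, Pi.smul_apply, smul_eq_mul] at this
      exact (mul_pos_iff_of_pos_left hy).1 this
    · have := h (Fin.last m)
      simp only [Fin.snoc_last] at this
      by_contra! h1
      nlinarith
  obtain ⟨j, hj⟩ := this
  simp only [mlPdfProd_eq_zero hj, mul_zero]

lemma measurable_jointPdf {m : ℕ} {ν : ℝ} (hν0 : 0 < ν) {β : Fin (m + 1) → ℝ}
    (hβ : ∀ j, 0 < β j) : Measurable (jointPdf m ν β) := by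
  have h1 : Measurable fun p : (Fin m → ℝ) × ℝ =>
      mlPdfProd ν β (Fin.snoc (p.2 • p.1) (p.2 - p.2 * ∑ j, p.1 j)) :=
    (measurable_mlPdfProd hν0 hβ).comp ((measurable_finSnoc m).comp (by fun_prop :
      Measurable fun p : (Fin m → ℝ) × ℝ => (p.2 • p.1, p.2 - p.2 * ∑ j, p.1 j)))
  exact Measurable.lintegral_prod_right' (f := fun p : (Fin m → ℝ) × ℝ => ENNReal.ofReal (p.2 ^ m) *
    mlPdfProd ν β (Fin.snoc (p.2 • p.1) (p.2 - p.2 * ∑ j, p.1 j))) (by fun_prop)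

/-- Under `jointPdf`, the vector `(Q_1, …, Q_{m+1})` is distributed as the proportions
`w_j / ∑ w` of independent Mittag-Leffler variables. -/
lemma lintegral_jointPdf_mul {m : ℕ} {ν : ℝ} (hν0 : 0 < ν) (hν1 : ν ≤ 1) {β : Fin (m + 1) → ℝ}
    (hβ : ∀ j, 0 < β j) (i : Fin (m + 1)) {φ : ℝ → ℝ≥0∞} (hφ : Measurable φ) :
    ∫⁻ q, jointPdf m ν β q * φ (coordQ m i q) =
      ∫⁻ w, φ (w i / ∑ k, w k) ∂Measure.pi fun j => mlMeasure ν (β j) := by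
  have hP := measurable_mlPdfProd hν0 hβ
  have hφm : Measurable fun w : Fin (m + 1) → ℝ => φ (w i / ∑ k, w k) := by fun_prop
  have hF : Measurable fun w : Fin (m + 1) → ℝ => mlPdfProd ν β w * φ (w i / ∑ k, w k) :=
    hP.mul hφm
  set ℓ : (Fin m → ℝ) →ₗ[ℝ] ℝ := ∑ j, LinearMap.proj j with hℓ
  have hℓa (x : Fin m → ℝ) : ℓ x = ∑ j, x j := by simp [hℓ]
  rw [pi_mlMeasure_eq_withDensity hν0 hν1 hβ, lintegral_withDensity_eq_lintegral_mul _ hP hφm]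
  simp only [Pi.mul_apply]
  rw [lintegral_eq_lintegral_finSnoc hF, lintegral_lintegral_eq_total_proportion ℓ
    (G := fun x z => mlPdfProd ν β (Fin.snoc x z) * φ ((Fin.snoc x z : Fin (m + 1) → ℝ) i /
      ∑ k, (Fin.snoc x z : Fin (m + 1) → ℝ) k)) (hF.comp (measurable_finSnoc m)) fun x z hxz => ?_]
  · refine lintegral_congr fun q => ?_
    rw [jointPdf, ← lintegral_mul_const]
    · refine setLIntegral_congr_fun measurableSet_Ioi fun y hy => ?_
      have hy : 0 < y := hy
      simp only [hℓa, coordQ_eq_snoc_div i q hy.ne', Module.finrank_fin_fun]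
      ring
    · exact (by fun_prop : Measurable fun y : ℝ => ENNReal.ofReal (y ^ m)).mul (hP.comp
        ((measurable_finSnoc m).comp (by fun_prop :
          Measurable fun y : ℝ => (y • q, y - y * ∑ j, q j))))
  · have : ∃ j, (Fin.snoc x z : Fin (m + 1) → ℝ) j ≤ 0 := by
      by_contra! h
      have h1 : 0 < ∑ j, (Fin.snoc x z : Fin (m + 1) → ℝ) j :=
        Finset.sum_pos (fun j _ => h j) Finset.univ_nonempty
      rw [Fin.sum_univ_castSucc] at h1
      simp only [Fin.snoc_castSucc, Fin.snoc_last] at h1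
      rw [hℓa] at hxz
      linarith
    obtain ⟨j, hj⟩ := this
    rw [mlPdfProd_eq_zero hj, zero_mul]

/-- Where the radial integral is finite, which is almost everywhere by Tonelli's theorem, the
Bochner integral in `jointDensity` takes no junk value and agrees with `jointPdf`. -/
lemma ofReal_jointDensity {m : ℕ} {ν : ℝ} (hν0 : 0 < ν) (hν1 : ν ≤ 1) {β : Fin (m + 1) → ℝ}
    (hβ : ∀ j, 0 < β j) {q : Fin m → ℝ} (hq : q ∈ openSimplex m) (hfin : jointPdf m ν β q ≠ ∞) :
    ENNReal.ofReal (jointDensity m ν β q) = jointPdf m ν β q := by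
  have hq1 : 0 < 1 - ∑ i, q i := sub_pos.2 hq.2
  set f : ℝ → ℝ := fun y => y ^ m * ((∏ i : Fin m, mlDensity ν (β i.castSucc) (y * q i)) *
    mlDensity ν (β (Fin.last m)) (y - y * ∑ i, q i)) with hf
  have hpos (y : ℝ) (hy : 0 < y) : 0 < y - y * ∑ i, q i := by
    rw [← mul_one_sub]
    exact mul_pos hy hq1
  have hnn (y : ℝ) (hy : 0 < y) (i : Fin m) : 0 ≤ mlDensity ν (β i.castSucc) (y * q i) :=
    mlDensity_nonneg hν0 hν1 (hβ _) (mul_pos hy (hq.1 i))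
  have hf0 : 0 ≤ᵐ[volume.restrict (Ioi 0)] f := by
    filter_upwards [ae_restrict_mem measurableSet_Ioi] with y hy
    have hy : 0 < y := hy
    exact mul_nonneg (by positivity) (mul_nonneg (Finset.prod_nonneg fun i _ => hnn y hy i)
      (mlDensity_nonneg hν0 hν1 (hβ _) (hpos y hy)))
  have hfm : Measurable f := by
    have h1 (i : Fin (m + 1)) := measurable_mlDensity hν0 (hβ i)
    refine (by fun_prop : Measurable fun y : ℝ => y ^ m).mul (Measurable.mul ?_ ?_)
    · exact Finset.measurable_fun_prod _ fun i _ =>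
        (h1 _).comp (by fun_prop : Measurable fun y : ℝ => y * q i)
    · exact (h1 _).comp (by fun_prop : Measurable fun y : ℝ => y - y * ∑ i, q i)
  have hlin : ∫⁻ y in Ioi (0 : ℝ), ENNReal.ofReal (f y) = jointPdf m ν β q := by
    refine setLIntegral_congr_fun measurableSet_Ioi fun y hy => ?_
    have hy : 0 < y := hy
    simp only [hf, mlPdfProd, Fin.prod_univ_castSucc, Fin.snoc_castSucc, Fin.snoc_last,
      Pi.smul_apply, smul_eq_mul]
    rw [mlPdf_of_pos (hpos y hy), ENNReal.ofReal_mul (by positivity),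
      ENNReal.ofReal_mul (Finset.prod_nonneg fun i _ => hnn y hy i),
      ENNReal.ofReal_prod_of_nonneg fun i _ => hnn y hy i]
    congr 3
    exact funext fun i => (mlPdf_of_pos (mul_pos hy (hq.1 i))).symm
  have hint : IntegrableOn f (Ioi 0) := by
    refine ⟨hfm.aestronglyMeasurable, ?_⟩
    rw [hasFiniteIntegral_iff_ofReal hf0, hlin]
    exact hfin.lt_top
  have hjd : jointDensity m ν β q = ∫ y in Ioi (0 : ℝ), f y := by
    rw [jointDensity, ← integral_const_mul]
    exact setIntegral_congr_fun measurableSet_Ioi fun y hy => jointIntegrand_eq β hq hy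
  rw [hjd, ofReal_integral_eq_lintegral_ofReal hint hf0, hlin]

lemma fracDirichlet_eq_withDensity {m : ℕ} {ν : ℝ} (hν0 : 0 < ν) (hν1 : ν ≤ 1)
    {β : Fin (m + 1) → ℝ} (hβ : ∀ j, 0 < β j) :
    fracDirichlet m ν β = volume.withDensity (jointPdf m ν β) := by
  have (j : Fin (m + 1)) := isFiniteMeasure_mlMeasure hν0 hν1 (hβ j)
  have htotal : ∫⁻ q, jointPdf m ν β q ≠ ∞ := by
    have h := lintegral_jointPdf_mul hν0 hν1 hβ 0 (φ := fun _ => 1) measurable_const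
    simp only [mul_one, lintegral_one] at h
    rw [h]
    exact measure_ne_top _ _
  have hae := ae_lt_top (measurable_jointPdf hν0 hβ) htotal
  have hind : jointPdf m ν β = (openSimplex m).indicator (jointPdf m ν β) := by
    ext q
    by_cases hq : q ∈ openSimplex m
    · rw [indicator_of_mem hq]
    · rw [indicator_of_notMem hq, jointPdf_eq_zero hq]
  rw [hind, withDensity_indicator (measurableSet_openSimplex m), fracDirichlet]
  refine withDensity_congr_ae ?_
  filter_upwards [ae_restrict_mem (measurableSet_openSimplex m), ae_restrict_of_ae hae] with q hq h
  exact ofReal_jointDensity hν0 hν1 hβ hq h.ne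

/-- One summand against the sum of the others: `w_i` and `∑_{j ≠ i} w_j` are independent, and the
latter has again a Mittag-Leffler distribution. -/
lemma lintegral_pi_mlMeasure_proportion {m : ℕ} (hm : 1 ≤ m) {ν : ℝ} (hν0 : 0 < ν) (hν1 : ν ≤ 1)
    {β : Fin (m + 1) → ℝ} (hβ : ∀ j, 0 < β j) (i : Fin (m + 1)) {φ : ℝ → ℝ≥0∞}
    (hφ : Measurable φ) :
    ∫⁻ w, φ (w i / ∑ k, w k) ∂(Measure.pi fun j => mlMeasure ν (β j)) =
      ∫⁻ p, φ (p.1 / (p.1 + p.2))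
        ∂(mlMeasure ν (β i)).prod (mlMeasure ν (∑ j, β (i.succAbove j))) := by
  have (j : Fin (m + 1)) := isFiniteMeasure_mlMeasure hν0 hν1 (hβ j)
  have hmp := measurePreserving_piFinSuccAbove (fun j => mlMeasure ν (β j)) i
  have hS : Measurable fun x : Fin m → ℝ => ∑ j, x j := by fun_prop
  have h1 : ∫⁻ w, φ (w i / ∑ k, w k) ∂(Measure.pi fun j => mlMeasure ν (β j)) =
      ∫⁻ p : ℝ × (Fin m → ℝ), φ (p.1 / (p.1 + ∑ j, p.2 j))
        ∂(mlMeasure ν (β i)).prod (Measure.pi fun j => mlMeasure ν (β (i.succAbove j))) := by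
    rw [← hmp.lintegral_comp_emb (MeasurableEquiv.measurableEmbedding _)]
    refine lintegral_congr fun w => ?_
    rw [Fin.sum_univ_succAbove _ i]
    rfl
  have := isFiniteMeasure_mlMeasure hν0 hν1 (hβ i)
  rw [h1, ← map_sum_pi_mlMeasure hν0 hν1 hm fun j => hβ (i.succAbove j),
    lintegral_prod _ (by fun_prop), lintegral_prod _ (by fun_prop)]
  refine lintegral_congr fun u => ?_
  rw [lintegral_map (by fun_prop) hS]

end FracDirichlet

theorem mainTheorem4 (m : ℕ) (hm : 1 ≤ m) (ν : ℝ) (hν0 : 0 < ν) (hν1 : ν ≤ 1)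
    (β : Fin (m + 1) → ℝ) (hβ : ∀ j, 0 < β j) (i : Fin (m + 1)) :
    (∀ q ∈ Set.Ioo (0 : ℝ) 1,
      MeasureTheory.IntegrableOn
        (FracDirichlet.marginalIntegrand ν (β i) (∑ j, β j) q) (Set.Ioi 0)
      ∧ 0 ≤ FracDirichlet.marginalDensity ν (β i) (∑ j, β j) q) ∧
    MeasureTheory.Measure.map (FracDirichlet.coordQ m i) (FracDirichlet.fracDirichlet m ν β)
      = (MeasureTheory.volume.restrict (Set.Ioo (0 : ℝ) 1)).withDensity
          (fun q => ENNReal.ofReal (FracDirichlet.marginalDensity ν (β i) (∑ j, β j) q)) := by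
  have hsum : ∑ j, β j - β i = ∑ j, β (i.succAbove j) := by
    rw [Fin.sum_univ_succAbove _ i, add_sub_cancel_left]
  have hbs : β i < ∑ j, β j := by
    have : NeZero m := ⟨by omega⟩
    rw [← sub_pos, hsum]
    exact Finset.sum_pos (fun j _ => hβ _) Finset.univ_nonempty
  refine ⟨fun q hq => ⟨FracDirichlet.integrableOn_marginalIntegrand hν0 hν1 (hβ i) hbs hq,
    FracDirichlet.marginalDensity_nonneg hν0 hν1 (hβ i) hbs hq⟩, ?_⟩
  refine Measure.ext_of_lintegral _ fun φ hφ => ?_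
  rw [lintegral_map hφ (FracDirichlet.measurable_coordQ i),
    FracDirichlet.fracDirichlet_eq_withDensity hν0 hν1 hβ,
    lintegral_withDensity_eq_lintegral_mul _ (FracDirichlet.measurable_jointPdf hν0 hβ)
      (g := fun q => φ (FracDirichlet.coordQ m i q))
      (hφ.comp (FracDirichlet.measurable_coordQ i)),
    lintegral_withDensity_eq_lintegral_mul₀
      (FracDirichlet.aemeasurable_marginalDensity hν0 hν1 (hβ i) hbs) hφ.aemeasurable]
  simp only [Pi.mul_apply]
  rw [FracDirichlet.lintegral_marginalDensity hν0 hν1 (hβ i) hbs hφ, hsum,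
    ← FracDirichlet.lintegral_pi_mlMeasure_proportion hm hν0 hν1 hβ i hφ]
  exact FracDirichlet.lintegral_jointPdf_mul hν0 hν1 hβ i hφ
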